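/- For complex $a,q$ with $|q|<1$ let $(a;q)_\infty=\prod_{k=0}^{\infty}(1-aq^k)$, and let $$R(q)=\frac{(q;q^5)_\infty(q^4;q^5)_\infty}{(q^2;q^5)_\infty(q^3;q^5)_\infty}\qquad(|q|<1)$$ be the Rogers–Ramanujan continued fraction in its product form, without the factor $q^{1/5}$. Define real sequences $A(n)$, $B(n)$, $D(n)$ by the power series expansions, valid for $|q|<1$, $$\frac{1}{R^5(q)}=\sum_{n=0}^{\infty}A(n)q^n,\qquad R^5(q)=\sum_{n=0}^{\infty}B(n)q^n,\qquad \frac{R(q^5)}{R^5(q)}=\sum_{n=0}^{\infty}D(n)q^n.$$ Here $R^5(q)$ means $(R(q))^5$. Then $A(5n)<0$ and $B(5n)<0$ for all integers $n\ge 1$, and $D(5n+1)>0$ for all integers $n\ge 0$. -/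

import Mathlib

/-- The `q`-shifted factorial `(a; q)_∞ = ∏_{k ≥ 0} (1 - a q ^ k)` for complex `a` and `q`
(used only for `‖q‖ < 1`, where the product converges absolutely). -/
noncomputable def qPochhammerInf (a q : ℂ) : ℂ :=
  ∏' k : ℕ, (1 - a * q ^ k)

/-- The Rogers–Ramanujan continued fraction, without its factor `q ^ (1/5)`, as the product
`(q; q^5)_∞ (q^4; q^5)_∞ / ((q^2; q^5)_∞ (q^3; q^5)_∞)`. -/
noncomputable def rogersRamanujanR (q : ℂ) : ℂ :=
  (qPochhammerInf q (q ^ 5) * qPochhammerInf (q ^ 4) (q ^ 5)) /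
    (qPochhammerInf (q ^ 2) (q ^ 5) * qPochhammerInf (q ^ 3) (q ^ 5))

/-- `f q = ∑ a n * q ^ n` on the open unit disc, as a convergent power series.
The sequence `a` is determined uniquely by `f`. -/
def HasUnitDiscExpansion (f : ℂ → ℂ) (a : ℕ → ℝ) : Prop :=
  ∀ q : ℂ, ‖q‖ < 1 → HasSum (fun n : ℕ => (a n : ℂ) * q ^ n) (f q)

/-!
Write `R = R(q)`, `e = (q; q)_∞ / (q^5; q^5)_∞` (`eulerQuotient`), and `R₅`, `e₅` for their values
at `q^5`. The sign patterns follow from the explicit dissections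

* `∑ A(5n) q^n = 1 / R - 25 q / (R e^6)`,
* `∑ B(5n) q^n = R - 25 q R / e^6`,
* `∑ D(5n+1) q^n = 5 (R + 3 q R / e^6 + q^2 (R / e)^6)`.

Here `R^{±1} / e^6` and `R / e` are products of factors `1 / (1 - q^m)`, hence have nonnegative
coefficients, while the coefficients of `R` and `1 / R` are at most those of `1 / e` in absolute
value. Since `1 / e` generates the partitions into parts prime to `5`, removing a part gives
`1 / e ≤ 1 + q / e^2` coefficientwise, and `1 / e^2 ≤ R^{±1} / e^6`. So the coefficient of `q^n`
in `R^{±1}` is, for `n ≥ 1`, at most the positive coefficient of `q^n` in `q R^{±1} / e^6`, and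
the factors `25` and `3` decide the signs (`abs_coeff_succ_le`, `one_le_coeff`).

The dissections rest on one theta function identity. With `θ(z; p)` the Jacobi theta product, the
double series of `θ(q; q^5) θ(q^2; q^5)` splits along the cosets of the lattice of index `5` with
orthogonal basis `(1, 2)`, `(2, -1)` into five products of theta functions with base `q^25`, two of
which vanish (`theta_mul_theta`). With `w = q R₅` this says `1 - w - w^2 = R₅ e e₅`
(`one_sub_sub_eq`). Multiplying over `q ↦ ζ q` for the fifth roots of unity `ζ` gives
`1 - 11 t - t^2 = R^5 e^6` for `t = q R^5` (`one_sub_eleven_mul_eq`). Eliminating `e` and `e₅` shows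
that `t` is a root of a quadratic polynomial with coefficients and roots in `ℂ(w)`; this is
Ramanujan's modular equation `R^5 = R₅ M(w) / N(w)` with the quartics `M` (`modularNum`) and `N`
(`modularDen`), see `rogersRamanujanR_pow_five`.
Since `M(w) N(w) (1 - w - w^2) = 1 - 11 w^5 - w^10 = R₅^5 e₅^6`, the quotient `M / N` becomes a
polynomial in `w` divided by a function of `q^5`, and the residue classes of exponents modulo `5`
can be read off.
-/

/-! ### Expansions on the unit disc and coefficientwise majorization -/

open Filter Topology

open PowerSeries in
/-- `Majorizes φ ψ` says that the coefficients of `ψ` bound those of `φ` in absolute value.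
In particular the coefficients of `ψ` are then nonnegative, and `Majorizes ψ ψ` says exactly
that. -/
def Majorizes (φ ψ : PowerSeries ℝ) : Prop :=
  ∀ n, |coeff n φ| ≤ coeff n ψ

/-- `Expands f φ` says that the real power series `φ` converges to `f` on the unit disc. -/
def Expands (f : ℂ → ℂ) (φ : PowerSeries ℝ) : Prop :=
  HasUnitDiscExpansion f fun n => PowerSeries.coeff n φ

namespace Majorizes

open PowerSeries

variable {φ ψ χ φ' ψ' : PowerSeries ℝ}

lemma coeff_nonneg (h : Majorizes φ ψ) (n : ℕ) : 0 ≤ coeff n ψ :=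
  (abs_nonneg _).trans (h n)

lemma of_nonneg (h : ∀ n, 0 ≤ coeff n φ) : Majorizes φ φ := fun n => (abs_of_nonneg (h n)).le

lemma self_right (h : Majorizes φ ψ) : Majorizes ψ ψ := of_nonneg h.coeff_nonneg

lemma trans (h : Majorizes φ ψ) (h' : Majorizes ψ χ) : Majorizes φ χ :=
  fun n => (h n).trans ((le_abs_self _).trans (h' n))

lemma add (h : Majorizes φ ψ) (h' : Majorizes φ' ψ') : Majorizes (φ + φ') (ψ + ψ') := fun n => by
  simpa using (abs_add_le _ _).trans (add_le_add (h n) (h' n))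

lemma mul (h : Majorizes φ ψ) (h' : Majorizes φ' ψ') : Majorizes (φ * φ') (ψ * ψ') := fun n => by
  rw [coeff_mul, coeff_mul]
  refine (Finset.abs_sum_le_sum_abs _ _).trans (Finset.sum_le_sum fun p _ => ?_)
  rw [abs_mul]
  exact mul_le_mul (h _) (h' _) (abs_nonneg _) (h.coeff_nonneg _)

lemma one : Majorizes 1 1 := of_nonneg fun n => by
  rw [coeff_one]; split_ifs <;> norm_num

lemma X : Majorizes X X := of_nonneg fun n => by
  rw [coeff_X]; split_ifs <;> norm_num

lemma pow (h : Majorizes φ ψ) (n : ℕ) : Majorizes (φ ^ n) (ψ ^ n) := by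
  induction n with
  | zero => simpa using one
  | succ n ih => simpa [pow_succ] using ih.mul h

end Majorizes

namespace Expands

open PowerSeries

variable {f g : ℂ → ℂ} {φ ψ : PowerSeries ℝ}

lemma congr (h : Expands f φ) (hfg : ∀ q : ℂ, ‖q‖ < 1 → g q = f q) : Expands g φ :=
  fun q hq => by simpa only [hfg q hq] using h q hq

lemma add (hf : Expands f φ) (hg : Expands g ψ) : Expands (fun q => f q + g q) (φ + ψ) :=
  fun q hq => by simpa [add_mul] using (hf q hq).add (hg q hq)

lemma sub (hf : Expands f φ) (hg : Expands g ψ) : Expands (fun q => f q - g q) (φ - ψ) :=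
  fun q hq => by simpa [sub_mul] using (hf q hq).sub (hg q hq)

lemma mul (hf : Expands f φ) (hg : Expands g ψ) : Expands (fun q => f q * g q) (φ * ψ) := by
  intro q hq
  have h1 := hf q hq
  have h2 := hg q hq
  have h3 := summable_sum_mul_antidiagonal_of_summable_norm' h1.summable.norm h1.summable
    h2.summable.norm h2.summable
  have h4 := tsum_mul_tsum_eq_tsum_sum_antidiagonal_of_summable_norm h1.summable.norm
    h2.summable.norm
  rw [h1.tsum_eq, h2.tsum_eq] at h4
  change HasSum _ (f q * g q)
  rw [h4]
  refine h3.hasSum.congr_fun fun n => ?_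
  beta_reduce
  rw [coeff_mul]
  push_cast
  rw [Finset.sum_mul]
  refine Finset.sum_congr rfl fun p hp => ?_
  rw [← Finset.HasAntidiagonal.mem_antidiagonal.mp hp, pow_add]
  ring

lemma const (c : ℝ) : Expands (fun _ => (c : ℂ)) (C c) := fun q _ => by
  have := hasSum_single (f := fun n : ℕ => ((coeff n (C c) : ℝ) : ℂ) * q ^ n) 0
    (fun n hn => by simp [coeff_C, hn])
  simpa using this

lemma id : Expands (fun q => q) X := fun q _ => by
  have := hasSum_single (f := fun n : ℕ => ((coeff n (X : PowerSeries ℝ) : ℝ) : ℂ) * q ^ n) 1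
    (fun n hn => by simp [coeff_X, hn])
  simpa using this

lemma one : Expands (fun _ => 1) 1 := by simpa using const 1

lemma pow (hf : Expands f φ) (n : ℕ) : Expands (fun q => f q ^ n) (φ ^ n) := by
  induction n with
  | zero => simpa using one
  | succ n ih => simpa [pow_succ] using ih.mul hf

lemma const_mul (c : ℝ) (hf : Expands f φ) : Expands (fun q => (c : ℂ) * f q) (C c * φ) :=
  (const c).mul hf

/-- A function with a convergent expansion is holomorphic on the unit disc. -/
lemma differentiableOn (hf : Expands f φ) : DifferentiableOn ℂ f (Metric.ball 0 1) := by
  intro z hz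
  rw [mem_ball_zero_iff] at hz
  obtain ⟨r, hzr, hr1⟩ := exists_between hz
  have hr0 : 0 < r := (norm_nonneg z).trans_lt hzr
  have hs : Summable fun n : ℕ => |coeff n φ| * r ^ n := by
    have := (hf (r : ℂ) (by simpa [abs_of_pos hr0] using hr1)).summable.norm
    simpa [abs_of_pos hr0] using this
  have hd : DifferentiableOn ℂ (fun w : ℂ => ∑' n : ℕ, ((coeff n φ : ℝ) : ℂ) * w ^ n)
      (Metric.ball 0 r) := by
    refine Complex.differentiableOn_tsum_of_summable_norm hs (fun n => by fun_prop)
      Metric.isOpen_ball ?_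
    intro n w hw
    rw [mem_ball_zero_iff] at hw
    simp only [norm_mul, norm_pow, Complex.norm_real, Real.norm_eq_abs]
    gcongr
  have hzb : Metric.ball (0 : ℂ) r ∈ 𝓝 z :=
    Metric.isOpen_ball.mem_nhds (by simpa using hzr)
  refine (((hd z (by simpa using hzr)).differentiableAt hzb).congr_of_eventuallyEq
    ?_).differentiableWithinAt
  filter_upwards [hzb] with w hw
  exact (hf w ((mem_ball_zero_iff.mp hw).trans hr1)).tsum_eq.symm

end Expands

/-- Interleaving: the coefficients of `∑ r < 5, q ^ r h_r(q ^ 5)` in the residue class of `r`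
modulo `5` are those of `h_r`. -/
lemma hasUnitDiscExpansion_dissection {h : Fin 5 → ℂ → ℂ} {φ : Fin 5 → PowerSeries ℝ}
    (hφ : ∀ r, Expands (h r) (φ r)) :
    HasUnitDiscExpansion (fun q => ∑ r : Fin 5, q ^ (r : ℕ) * h r (q ^ 5))
      (fun n => PowerSeries.coeff (n / 5) (φ (Fin.ofNat 5 n))) := by
  intro q hq
  have hq5 : ‖q ^ 5‖ < 1 := by
    rw [norm_pow]; exact pow_lt_one₀ (norm_nonneg _) hq (by norm_num)
  have key : ∀ r : Fin 5, HasSum (fun n : ℕ => if Fin.ofNat 5 n = r then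
      ((PowerSeries.coeff (n / 5) (φ r) : ℝ) : ℂ) * q ^ n else 0)
      (q ^ (r : ℕ) * h r (q ^ 5)) := by
    intro r
    have hinj : Function.Injective fun m : ℕ => 5 * m + (r : ℕ) := fun a b hab => by
      simp only at hab; omega
    rw [← hinj.hasSum_iff]
    · refine ((hφ r (q ^ 5) hq5).mul_left (q ^ (r : ℕ))).congr_fun fun m => ?_
      have h1 : Fin.ofNat 5 (5 * m + (r : ℕ)) = r := by
        ext; simp [Fin.ofNat, Nat.mod_eq_of_lt r.isLt]
      have h2 : (5 * m + (r : ℕ)) / 5 = m := by have := r.isLt; omega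
      simp only [Function.comp, h1, h2, if_true]
      ring
    · intro n hn
      rw [if_neg]
      rintro rfl
      exact hn ⟨n / 5, by simp [Fin.ofNat]; omega⟩
  refine (hasSum_sum fun r _ => key r).congr_fun fun n => ?_
  simp

/-! ### Infinite products over a residue class modulo 5 -/

section

open PowerSeries

lemma multipliable_one_sub_mul_pow (a : ℂ) {p : ℂ} (hp : ‖p‖ < 1) :
    Multipliable fun k : ℕ => 1 - a * p ^ k := by
  simp_rw [sub_eq_add_neg]
  apply multipliable_one_add_of_summable
  simpa [norm_mul] using (summable_geometric_of_lt_one (norm_nonneg _) hp).mul_left ‖a‖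

lemma tendsto_prod_qPochhammerInf (a : ℂ) {p : ℂ} (hp : ‖p‖ < 1) :
    Tendsto (fun N => ∏ k ∈ Finset.range N, (1 - a * p ^ k)) atTop (𝓝 (qPochhammerInf a p)) :=
  (multipliable_one_sub_mul_pow a hp).hasProd.tendsto_prod_nat

lemma one_sub_mul_pow_ne_zero {a p : ℂ} (ha : ‖a‖ < 1) (hp : ‖p‖ < 1) (k : ℕ) :
    1 - a * p ^ k ≠ 0 := by
  intro h
  have h1 : ‖a * p ^ k‖ = 1 := by rw [← sub_eq_zero.mp h, norm_one]
  rw [norm_mul, norm_pow] at h1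
  have h2 : ‖p‖ ^ k ≤ 1 := pow_le_one₀ (norm_nonneg _) hp.le
  nlinarith [norm_nonneg a, norm_nonneg p, pow_nonneg (norm_nonneg p) k]

lemma qPochhammerInf_ne_zero {a p : ℂ} (ha : ‖a‖ < 1) (hp : ‖p‖ < 1) :
    qPochhammerInf a p ≠ 0 := by
  unfold qPochhammerInf
  have h := one_sub_mul_pow_ne_zero ha hp
  simp_rw [sub_eq_add_neg] at h ⊢
  apply tprod_one_add_ne_zero_of_summable h
  simpa [norm_mul] using (summable_geometric_of_lt_one (norm_nonneg _) hp).mul_left ‖a‖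

lemma norm_pow_lt_one_of_pos {q : ℂ} (hq : ‖q‖ < 1) {c : ℕ} (hc : 0 < c) : ‖q ^ c‖ < 1 := by
  rw [norm_pow]; exact pow_lt_one₀ (norm_nonneg _) hq hc.ne'


/-- The series `∑ k, X ^ (m * k)`, that is `1 / (1 - X ^ m)` when `0 < m`. -/
noncomputable def geomSeries (m : ℕ) : PowerSeries ℝ := mk fun n => if m ∣ n then 1 else 0

lemma one_sub_X_pow_mul_geomSeries {m : ℕ} (hm : 0 < m) : (1 - X ^ m) * geomSeries m = 1 := by
  ext n
  rw [sub_mul, one_mul, map_sub, coeff_X_pow_mul', geomSeries, coeff_mk, coeff_mk, coeff_one]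
  rcases lt_or_ge n m with h | h
  · have : m ∣ n ↔ n = 0 := ⟨fun hd => Nat.eq_zero_of_dvd_of_lt hd h, fun h0 => h0 ▸ dvd_zero m⟩
    simp [this, not_le.mpr h]
  · have h1 : m ∣ n - m ↔ m ∣ n := (Nat.dvd_sub_iff_left h dvd_rfl)
    have h2 : n ≠ 0 := by omega
    simp [h1, h2, h]

lemma geomSeries_eq {m : ℕ} (hm : 0 < m) : geomSeries m = 1 + X ^ m * geomSeries m := by
  linear_combination one_sub_X_pow_mul_geomSeries hm

lemma expands_geomSeries {m : ℕ} (hm : 0 < m) :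
    Expands (fun q => (1 - q ^ m)⁻¹) (geomSeries m) := by
  intro q hq
  have hinj : Function.Injective fun k : ℕ => m * k := fun a b h => Nat.eq_of_mul_eq_mul_left hm h
  rw [← hinj.hasSum_iff]
  · refine (hasSum_geometric_of_norm_lt_one (norm_pow_lt_one_of_pos hq hm)).congr_fun fun k => ?_
    simp [geomSeries, pow_mul]
  · intro n hn
    have : ¬ m ∣ n := fun ⟨k, hk⟩ => hn ⟨k, hk.symm⟩
    simp [geomSeries, this]

/-- The finite product `∏ k < N, (1 - X ^ (5 * k + c))`. -/
noncomputable def residueProd (c N : ℕ) : PowerSeries ℝ :=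
  ∏ k ∈ Finset.range N, (1 - X ^ (5 * k + c))

/-- The finite product `∏ k < N, 1 / (1 - X ^ (5 * k + c))`, the generating function of partitions
into parts from `{c, c + 5, …, c + 5 (N - 1)}`. -/
noncomputable def residueProdInv (c N : ℕ) : PowerSeries ℝ :=
  ∏ k ∈ Finset.range N, geomSeries (5 * k + c)

/-- The indicator series of the natural numbers congruent to `c` modulo `5`, for `c < 5`. -/
noncomputable def residueIndicator (c : ℕ) : PowerSeries ℝ := mk fun n => if n % 5 = c then 1 else 0

section

variable {c : ℕ}

lemma residueProd_succ (c N : ℕ) :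
    residueProd c (N + 1) = residueProd c N * (1 - X ^ (5 * N + c)) := Finset.prod_range_succ _ _

lemma residueProdInv_succ (c N : ℕ) :
    residueProdInv c (N + 1) = residueProdInv c N * geomSeries (5 * N + c) :=
  Finset.prod_range_succ _ _

lemma majorizes_one_sub_X_pow {m : ℕ} (hm : 0 < m) : Majorizes (1 - X ^ m) (geomSeries m) := by
  intro n
  rw [geomSeries, coeff_mk, map_sub, coeff_one, coeff_X_pow]
  by_cases h0 : n = 0
  · simp [h0, hm.ne]
  · by_cases h1 : n = m
    · simp [h1, hm.ne']
    · simp only [h0, h1, if_false]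
      split_ifs <;> norm_num

lemma majorizes_one_geomSeries (m : ℕ) : Majorizes 1 (geomSeries m) := by
  intro n
  rw [geomSeries, coeff_mk, coeff_one]
  by_cases h0 : n = 0
  · simp [h0]
  · simp only [h0, if_false]
    split_ifs <;> norm_num

lemma residueProd_majorizes (hc : 0 < c) (N : ℕ) :
    Majorizes (residueProd c N) (residueProdInv c N) := by
  induction N with
  | zero => simpa [residueProd, residueProdInv] using Majorizes.one
  | succ N ih =>
    rw [residueProd_succ, residueProdInv_succ]
    exact ih.mul (majorizes_one_sub_X_pow (by omega))

lemma residueProdInv_majorizes_succ (hc : 0 < c) (N : ℕ) :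
    Majorizes (residueProdInv c N) (residueProdInv c (N + 1)) := by
  rw [residueProdInv_succ]
  simpa using (residueProd_majorizes hc N).self_right.mul
    (majorizes_one_geomSeries (5 * N + c))

/-- Classifying partitions into finitely many parts by their largest part: a nonempty partition is
obtained by adding a part to a partition. -/
lemma residueProdInv_majorizes_one_add (hc : 0 < c) (N : ℕ) :
    Majorizes (residueProdInv c N)
      (1 + (∑ k ∈ Finset.range N, X ^ (5 * k + c)) * residueProdInv c N) := by
  induction N with
  | zero => simpa [residueProdInv] using Majorizes.one
  | succ N ih =>
    have hm : 0 < 5 * N + c := by omega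
    have hU := residueProdInv_majorizes_succ hc N
    have hQ : Majorizes (∑ k ∈ Finset.range N, (X : PowerSeries ℝ) ^ (5 * k + c))
        (∑ k ∈ Finset.range N, X ^ (5 * k + c)) := Majorizes.of_nonneg fun n => by
      rw [map_sum]
      exact Finset.sum_nonneg fun k _ => (Majorizes.X.pow _).coeff_nonneg n
    have h1 : residueProdInv c (N + 1) =
        residueProdInv c N + X ^ (5 * N + c) * residueProdInv c (N + 1) := by
      rw [residueProdInv_succ]
      linear_combination residueProdInv c N * geomSeries_eq hm
    have h2 : Majorizes (residueProdInv c N + X ^ (5 * N + c) * residueProdInv c (N + 1))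
        (1 + (∑ k ∈ Finset.range N, X ^ (5 * k + c)) * residueProdInv c (N + 1) +
          X ^ (5 * N + c) * residueProdInv c (N + 1)) :=
      (ih.trans (Majorizes.one.add (hQ.mul hU))).add ((Majorizes.X.pow _).mul hU.self_right)
    rw [← h1] at h2
    rw [Finset.sum_range_succ, add_mul, ← add_assoc]
    exact h2

lemma sum_X_pow_majorizes (hc5 : c < 5) (N : ℕ) :
    Majorizes (∑ k ∈ Finset.range N, X ^ (5 * k + c)) (residueIndicator c) := by
  intro n
  rw [map_sum, residueIndicator, coeff_mk]
  simp_rw [coeff_X_pow]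
  have h : ∀ k, (if n = 5 * k + c then (1 : ℝ) else 0) =
      if k = n / 5 then (if n % 5 = c then 1 else 0) else 0 := by
    intro k
    by_cases h1 : n = 5 * k + c
    · rw [if_pos h1, if_pos (by omega), if_pos (by omega)]
    · rw [if_neg h1]
      split_ifs <;> first | rfl | omega
  simp_rw [h, Finset.sum_ite_eq']
  split_ifs <;> norm_num

lemma coeff_residueProd_stable {N n : ℕ} (h : n < N) :
    coeff n (residueProd c N) = coeff n (residueProd c (n + 1)) := by
  induction N, h using Nat.le_induction with
  | base => rfl
  | succ N hN ih =>
    rw [residueProd_succ, mul_sub, mul_one, map_sub, coeff_mul_X_pow', if_neg (by omega), sub_zero,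
      ih]

lemma coeff_residueProdInv_stable (hc : 0 < c) {N n : ℕ} (h : n < N) :
    coeff n (residueProdInv c N) = coeff n (residueProdInv c (n + 1)) := by
  induction N, h using Nat.le_induction with
  | base => rfl
  | succ N hN ih =>
    rw [residueProdInv_succ, geomSeries_eq (by omega), mul_add, mul_one, mul_left_comm, map_add,
      coeff_X_pow_mul', if_neg (by omega), add_zero, ih]

/-- The infinite product `∏ k, (1 - X ^ (5 * k + c))`; its `n`-th coefficient is that of any finite
product with more than `n` factors. -/
noncomputable def residueSeries (c : ℕ) : PowerSeries ℝ :=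
  mk fun n => coeff n (residueProd c (n + 1))

/-- The infinite product `∏ k, 1 / (1 - X ^ (5 * k + c))`; its `n`-th coefficient is that of any
finite product with more than `n` factors. -/
noncomputable def residueSeriesInv (c : ℕ) : PowerSeries ℝ :=
  mk fun n => coeff n (residueProdInv c (n + 1))

lemma coeff_residueSeries {N n : ℕ} (h : n < N) :
    coeff n (residueSeries c) = coeff n (residueProd c N) := by
  rw [residueSeries, coeff_mk, coeff_residueProd_stable h]

lemma coeff_residueSeriesInv (hc : 0 < c) {N n : ℕ} (h : n < N) :
    coeff n (residueSeriesInv c) = coeff n (residueProdInv c N) := by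
  rw [residueSeriesInv, coeff_mk, coeff_residueProdInv_stable hc h]

lemma residueSeries_majorizes (hc : 0 < c) : Majorizes (residueSeries c) (residueSeriesInv c) := by
  intro n
  rw [coeff_residueSeries n.lt_succ_self, coeff_residueSeriesInv hc n.lt_succ_self]
  exact residueProd_majorizes hc _ n

lemma residueProdInv_majorizes (hc : 0 < c) (N : ℕ) :
    Majorizes (residueProdInv c N) (residueSeriesInv c) := by
  intro n
  have hmono : ∀ M, N ≤ M → Majorizes (residueProdInv c N) (residueProdInv c M) := by
    intro M hM
    induction M, hM using Nat.le_induction with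
    | base => exact (residueProd_majorizes hc N).self_right
    | succ M _ ih => exact ih.trans (residueProdInv_majorizes_succ hc M)
  rw [coeff_residueSeriesInv hc (show n < N + n + 1 by omega)]
  exact hmono _ (by omega) n

lemma residueSeriesInv_majorizes_one_add (hc : 0 < c) (hc5 : c < 5) :
    Majorizes (residueSeriesInv c) (1 + residueIndicator c * residueSeriesInv c) := by
  intro n
  have h1 : Majorizes (residueProdInv c (n + 1)) (1 + residueIndicator c * residueSeriesInv c) :=
    (residueProdInv_majorizes_one_add hc _).trans
      (Majorizes.one.add ((sum_X_pow_majorizes hc5 _).mul (residueProdInv_majorizes hc _)))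
  rw [coeff_residueSeriesInv hc n.lt_succ_self]
  exact h1 n

lemma one_majorizes_residueSeriesInv (hc : 0 < c) : Majorizes 1 (residueSeriesInv c) := by
  simpa [residueProdInv] using residueProdInv_majorizes hc 0

lemma mk_one_majorizes_residueSeriesInv : Majorizes (mk 1) (residueSeriesInv 1) := by
  have h : residueProdInv 1 1 = mk 1 := by
    ext n; simp [residueProdInv, geomSeries]
  exact h ▸ residueProdInv_majorizes one_pos 1

lemma expands_residueProd (c N : ℕ) :
    Expands (fun q => ∏ k ∈ Finset.range N, (1 - q ^ c * (q ^ 5) ^ k)) (residueProd c N) := by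
  induction N with
  | zero => simpa [residueProd] using Expands.one
  | succ N ih =>
    rw [residueProd_succ]
    refine (ih.mul (Expands.one.sub (Expands.id.pow (5 * N + c)))).congr fun q _ => ?_
    rw [Finset.prod_range_succ]
    ring

lemma expands_residueProdInv (hc : 0 < c) (N : ℕ) :
    Expands (fun q => (∏ k ∈ Finset.range N, (1 - q ^ c * (q ^ 5) ^ k))⁻¹)
      (residueProdInv c N) := by
  induction N with
  | zero => simpa [residueProdInv] using Expands.one
  | succ N ih =>
    rw [residueProdInv_succ]
    refine (ih.mul (expands_geomSeries (m := 5 * N + c) (by omega))).congr fun q _ => ?_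
    rw [Finset.prod_range_succ, mul_inv]
    ring

lemma summable_residueSeriesInv (hc : 0 < c) {r : ℝ} (hr0 : 0 ≤ r) (hr1 : r < 1) :
    Summable fun n => coeff n (residueSeriesInv c) * r ^ n := by
  have hr : ‖(r : ℂ)‖ < 1 := by simpa [abs_of_nonneg hr0] using hr1
  have hlim := ((tendsto_prod_qPochhammerInf ((r : ℂ) ^ c) (norm_pow_lt_one_of_pos hr
    (by norm_num : 0 < 5))).inv₀ (qPochhammerInf_ne_zero (norm_pow_lt_one_of_pos hr hc)
    (norm_pow_lt_one_of_pos hr (by norm_num)))).norm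
  obtain ⟨K, hK⟩ := hlim.bddAbove_range
  have hnn : ∀ n, 0 ≤ coeff n (residueSeriesInv c) :=
    (one_majorizes_residueSeriesInv hc).coeff_nonneg
  -- the first `M` terms of the series are terms of the expansion of the `M`-th partial product
  refine summable_of_sum_range_le (c := K)
    (fun n => mul_nonneg (hnn n) (pow_nonneg hr0 n)) fun M => ?_
  refine le_trans ?_ (hK ⟨M, rfl⟩)
  have hs := expands_residueProdInv hc M r hr
  have hs' : HasSum (fun n => coeff n (residueProdInv c M) * r ^ n)
      (∏ k ∈ Finset.range M, (1 - r ^ c * (r ^ 5) ^ k))⁻¹ := by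
    rw [← Complex.hasSum_ofReal]
    push_cast
    exact hs
  have hnn' := (residueProd_majorizes hc M).coeff_nonneg
  calc ∑ n ∈ Finset.range M, coeff n (residueSeriesInv c) * r ^ n
      = ∑ n ∈ Finset.range M, coeff n (residueProdInv c M) * r ^ n :=
        Finset.sum_congr rfl fun n hn => by
          rw [coeff_residueSeriesInv hc (Finset.mem_range.mp hn)]
    _ ≤ (∏ k ∈ Finset.range M, (1 - r ^ c * (r ^ 5) ^ k))⁻¹ :=
        sum_le_hasSum _ (fun n _ => mul_nonneg (hnn' n) (pow_nonneg hr0 n)) hs'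
    _ ≤ _ := by
        refine (le_abs_self _).trans (le_of_eq ?_)
        rw [← Real.norm_eq_abs, ← Complex.norm_real]
        push_cast
        rfl

/-- Coefficientwise limits of expansions dominated by the series of `residueSeriesInv c`. -/
lemma expands_of_tendsto (hc : 0 < c) {F : ℕ → ℂ → ℂ} {f : ℂ → ℂ} {Φ : ℕ → PowerSeries ℝ}
    {φ : PowerSeries ℝ} (hF : ∀ N, Expands (F N) (Φ N))
    (hlim : ∀ q : ℂ, ‖q‖ < 1 → Tendsto (fun N => F N q) atTop (𝓝 (f q)))
    (hst : ∀ n N, n < N → coeff n φ = coeff n (Φ N))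
    (hbd : ∀ N, Majorizes (Φ N) (residueSeriesInv c)) : Expands f φ := by
  intro q hq
  have hsum := summable_residueSeriesInv hc (norm_nonneg q) hq
  have hb : ∀ N n, ‖((coeff n (Φ N) : ℝ) : ℂ) * q ^ n‖ ≤
      coeff n (residueSeriesInv c) * ‖q‖ ^ n := fun N n => by
    rw [norm_mul, norm_pow, Complex.norm_real, Real.norm_eq_abs]
    exact mul_le_mul_of_nonneg_right (hbd N n) (by positivity)
  have hφ : Summable fun n => ((coeff n φ : ℝ) : ℂ) * q ^ n :=
    Summable.of_norm_bounded hsum fun n => by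
      rw [hst n (n + 1) n.lt_succ_self]; exact hb _ n
  have htend := tendsto_tsum_of_dominated_convergence (𝓕 := atTop)
    (f := fun N n => ((coeff n (Φ N) : ℝ) : ℂ) * q ^ n)
    (g := fun n => ((coeff n φ : ℝ) : ℂ) * q ^ n) hsum
    (fun n => by
      refine tendsto_const_nhds.congr' ?_
      filter_upwards [eventually_gt_atTop n] with N hN
      rw [hst n N hN])
    (Eventually.of_forall fun N n => hb N n)
  have : ∑' n, ((coeff n φ : ℝ) : ℂ) * q ^ n = f q := by
    refine tendsto_nhds_unique htend ((hlim q hq).congr fun N => ?_)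
    exact (hF N q hq).tsum_eq.symm
  rw [← this]
  exact hφ.hasSum

lemma expands_residueSeries (hc : 0 < c) :
    Expands (fun q => qPochhammerInf (q ^ c) (q ^ 5)) (residueSeries c) :=
  expands_of_tendsto hc (expands_residueProd c)
    (fun q hq => tendsto_prod_qPochhammerInf _ (norm_pow_lt_one_of_pos hq (by norm_num)))
    (fun _ _ h => coeff_residueSeries h)
    (fun N => (residueProd_majorizes hc N).trans (residueProdInv_majorizes hc N))

lemma expands_residueSeriesInv (hc : 0 < c) :
    Expands (fun q => (qPochhammerInf (q ^ c) (q ^ 5))⁻¹) (residueSeriesInv c) :=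
  expands_of_tendsto hc (expands_residueProdInv hc)
    (fun q hq => (tendsto_prod_qPochhammerInf _ (norm_pow_lt_one_of_pos hq (by norm_num))).inv₀
      (qPochhammerInf_ne_zero (norm_pow_lt_one_of_pos hq hc)
        (norm_pow_lt_one_of_pos hq (by norm_num))))
    (fun _ _ h => coeff_residueSeriesInv hc h) (residueProdInv_majorizes hc)

end

end

/-! ### The Jacobi triple product -/

/-- The finite product `(p; p)_k = ∏ i < k, (1 - p ^ (i + 1))`. -/
noncomputable def qFactorial (p : ℂ) (k : ℕ) : ℂ := ∏ i ∈ Finset.range k, (1 - p * p ^ i)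

/-- The Gaussian binomial coefficient, defined by the Pascal recursion with respect to the last
factor of `∏ k < M, (1 - x p ^ k)`. -/
noncomputable def gaussBinom (p : ℂ) : ℕ → ℕ → ℂ
  | _, 0 => 1
  | 0, _ + 1 => 0
  | M + 1, j + 1 => gaussBinom p M (j + 1) + p ^ (M - j) * gaussBinom p M j

section

variable {p : ℂ}

@[simp] lemma gaussBinom_zero_right (p : ℂ) (M : ℕ) : gaussBinom p M 0 = 1 := by
  cases M <;> rfl

lemma gaussBinom_succ_succ (p : ℂ) (M j : ℕ) :
    gaussBinom p (M + 1) (j + 1) = gaussBinom p M (j + 1) + p ^ (M - j) * gaussBinom p M j := rfl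

lemma gaussBinom_eq_zero_of_lt (p : ℂ) {M j : ℕ} (h : M < j) : gaussBinom p M j = 0 := by
  induction M generalizing j with
  | zero =>
    obtain ⟨j, rfl⟩ := Nat.exists_eq_add_of_lt h
    rfl
  | succ M ih =>
    obtain ⟨j, rfl⟩ : ∃ i, j = i + 1 := ⟨j - 1, by omega⟩
    rw [gaussBinom_succ_succ, ih (by omega), ih (by omega)]
    simp

lemma qFactorial_succ (p : ℂ) (k : ℕ) :
    qFactorial p (k + 1) = qFactorial p k * (1 - p ^ (k + 1)) := by
  rw [qFactorial, Finset.prod_range_succ, ← qFactorial, pow_succ']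

@[simp] lemma qFactorial_zero (p : ℂ) : qFactorial p 0 = 1 := rfl

lemma gaussBinom_self (p : ℂ) (M : ℕ) : gaussBinom p M M = 1 := by
  induction M with
  | zero => rfl
  | succ M ih => rw [gaussBinom_succ_succ, gaussBinom_eq_zero_of_lt p M.lt_succ_self, ih]; simp

lemma gaussBinom_mul_qFactorial (p : ℂ) (i j : ℕ) :
    gaussBinom p (i + j) j * (qFactorial p i * qFactorial p j) = qFactorial p (i + j) := by
  induction j generalizing i with
  | zero => simp
  | succ j ihj =>
    induction i with
    | zero => simp [gaussBinom_self]
    | succ i ihi =>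
      have h1 : i + 1 + (j + 1) = (i + 1 + j) + 1 := by omega
      have h2 : i + (j + 1) = i + 1 + j := by omega
      have h3 := ihj (i + 1)
      rw [h2] at ihi
      rw [h1, gaussBinom_succ_succ, qFactorial_succ p (i + 1 + j),
        show i + 1 + j - j = i + 1 by omega]
      rw [qFactorial_succ p i] at h3 ⊢
      rw [qFactorial_succ p j] at ihi ⊢
      rw [show i + 1 + j + 1 = (i + 1) + (j + 1) by omega, pow_add p (i + 1) (j + 1)]
      linear_combination (1 - p ^ (i + 1)) * ihi + p ^ (i + 1) * (1 - p ^ (j + 1)) * h3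

/-- The finite `q`-binomial theorem of Gauss. -/
lemma prod_one_sub_mul_pow (p x : ℂ) (M : ℕ) :
    ∏ k ∈ Finset.range M, (1 - x * p ^ k) =
      ∑ j ∈ Finset.range (M + 1), (-1) ^ j * p ^ (j.choose 2) * x ^ j * gaussBinom p M j := by
  induction M with
  | zero => simp
  | succ M ih =>
    have hstep : ∀ j ∈ Finset.range (M + 1),
        (-1) ^ (j + 1) * p ^ ((j + 1).choose 2) * x ^ (j + 1) * gaussBinom p (M + 1) (j + 1) =
        (-1) ^ (j + 1) * p ^ ((j + 1).choose 2) * x ^ (j + 1) * gaussBinom p M (j + 1) -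
          x * p ^ M * ((-1) ^ j * p ^ (j.choose 2) * x ^ j * gaussBinom p M j) := by
      intro j hj
      have hj' : j ≤ M := Nat.lt_succ_iff.mp (Finset.mem_range.mp hj)
      have h1 : p ^ M = p ^ (M - j) * p ^ j := by rw [← pow_add]; congr 1; omega
      rw [gaussBinom_succ_succ, Nat.choose_succ_succ' j 1, Nat.choose_one_right, pow_add, h1]
      ring
    have h0 := Finset.sum_range_succ' (fun j => (-1) ^ j * p ^ (j.choose 2) * x ^ j *
      gaussBinom p M j) (M + 1)
    rw [Finset.sum_range_succ, gaussBinom_eq_zero_of_lt p M.lt_succ_self] at h0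
    rw [Finset.prod_range_succ, ih, Finset.sum_range_succ' _ (M + 1), Finset.sum_congr rfl hstep,
      Finset.sum_sub_distrib, ← Finset.mul_sum]
    simp only [gaussBinom_zero_right] at h0 ⊢
    linear_combination h0

/-- The `n`-th term of the theta series `∑ n : ℤ, (-1) ^ n p ^ (n (n - 1) / 2) z ^ n`. -/
noncomputable def thetaTerm (z p : ℂ) (n : ℤ) : ℂ := (-1) ^ n * p ^ (n * (n - 1) / 2) * z ^ n

lemma two_mul_triangle (n : ℤ) : 2 * (n * (n - 1) / 2) = n * (n - 1) :=
  Int.mul_ediv_cancel' (Int.even_mul_pred_self n).two_dvd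

lemma thetaTerm_eq_pow_succ {z : ℂ} (hz : z ≠ 0) (n : ℤ) (hp0 : p ≠ 0) :
    thetaTerm z p (n + 1) = -(z * p ^ n) * thetaTerm z p n := by
  have h : (n + 1) * (n + 1 - 1) / 2 = n * (n - 1) / 2 + n := by
    have h1 := two_mul_triangle (n + 1)
    have h2 := two_mul_triangle n
    linarith
  rw [thetaTerm, thetaTerm, h, zpow_add₀ hp0, zpow_add_one₀ hz, zpow_add_one₀ (by norm_num)]
  ring

lemma thetaTerm_ne_zero {z : ℂ} (hz : z ≠ 0) (hp0 : p ≠ 0) (n : ℤ) : thetaTerm z p n ≠ 0 :=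
  mul_ne_zero (mul_ne_zero (zpow_ne_zero _ (by norm_num)) (zpow_ne_zero _ hp0)) (zpow_ne_zero _ hz)

lemma summable_thetaTerm {z : ℂ} (hz : z ≠ 0) (hp0 : p ≠ 0) (hp : ‖p‖ < 1) :
    Summable (thetaTerm z p) := by
  have hlim : Tendsto (fun n : ℕ => ‖p‖ ^ n) atTop (𝓝 0) :=
    tendsto_pow_atTop_nhds_zero_of_lt_one (norm_nonneg _) hp
  have hn : ∀ n, ‖thetaTerm z p n‖ ≠ 0 := fun n => norm_ne_zero_iff.mpr (thetaTerm_ne_zero hz hp0 n)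
  refine Summable.of_nat_of_neg ?_ ?_
  · refine summable_of_ratio_test_tendsto_lt_one (l := 0) one_pos
      (Eventually.of_forall fun n => thetaTerm_ne_zero hz hp0 n) ?_
    have := hlim.const_mul ‖z‖
    rw [mul_zero] at this
    refine this.congr fun n => ?_
    push_cast
    rw [thetaTerm_eq_pow_succ hz _ hp0, norm_mul, mul_div_cancel_right₀ _ (hn _), norm_neg,
      norm_mul, zpow_natCast, norm_pow]
  · refine summable_of_ratio_test_tendsto_lt_one (l := 0) one_pos
      (Eventually.of_forall fun n => thetaTerm_ne_zero hz hp0 _) ?_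
    have := (hlim.const_mul (‖z‖⁻¹ * ‖p‖))
    rw [mul_zero] at this
    refine this.congr fun n => ?_
    have h1 := thetaTerm_eq_pow_succ hz (-((n + 1 : ℕ) : ℤ)) hp0
    rw [show -((n + 1 : ℕ) : ℤ) + 1 = -(n : ℤ) by push_cast; ring] at h1
    rw [h1, norm_mul, norm_neg, norm_mul, zpow_neg, zpow_natCast, norm_inv, norm_pow,
      div_mul_cancel_right₀ (hn _), mul_inv, inv_inv, pow_succ]
    ring

/-- The coefficient of `thetaTerm z p n` in the finite form of the triple product. -/
noncomputable def centralGaussBinom (p : ℂ) (N : ℕ) (n : ℤ) : ℂ :=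
  if n ∈ Finset.Icc (-(N : ℤ)) N then gaussBinom p (2 * N) (n + N).toNat else 0

lemma thetaTerm_sub {z : ℂ} (hz : z ≠ 0) (hp0 : p ≠ 0) (N j : ℕ) :
    thetaTerm z p (j - N) =
      thetaTerm z p (-N) * ((-1) ^ j * p ^ (j.choose 2) * (z * p ^ (-(N : ℤ))) ^ j) := by
  induction j with
  | zero => simp
  | succ j ih =>
    rw [show ((j + 1 : ℕ) : ℤ) - N = (j - N : ℤ) + 1 by push_cast; ring,
      thetaTerm_eq_pow_succ hz _ hp0, ih, Nat.choose_succ_succ' j 1, Nat.choose_one_right, pow_add,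
      sub_eq_neg_add, zpow_add₀ hp0, zpow_natCast]
    ring

lemma thetaTerm_neg_mul_prod {z : ℂ} (hz : z ≠ 0) (hp0 : p ≠ 0) (N : ℕ) :
    thetaTerm z p (-N) * ∏ k ∈ Finset.range N, (1 - z * p ^ (-((k + 1 : ℕ) : ℤ))) =
      ∏ k ∈ Finset.range N, (1 - p / z * p ^ k) := by
  induction N with
  | zero => simp [thetaTerm]
  | succ N ih =>
    have h := thetaTerm_eq_pow_succ hz (-((N + 1 : ℕ) : ℤ)) hp0
    rw [show -((N + 1 : ℕ) : ℤ) + 1 = -(N : ℤ) by push_cast; ring] at h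
    rw [Finset.prod_range_succ, Finset.prod_range_succ, ← ih, h, zpow_neg, zpow_natCast, pow_succ]
    field_simp
    ring

/-- The finite form of the Jacobi triple product: Gauss's binomial theorem for `2 N` factors,
centred by the substitution `x = z p ^ (-N)`. -/
lemma finite_triple_product {z : ℂ} (hz : z ≠ 0) (hp0 : p ≠ 0) (N : ℕ) :
    (∏ k ∈ Finset.range N, (1 - z * p ^ k)) * ∏ k ∈ Finset.range N, (1 - p / z * p ^ k) =
      ∑' n : ℤ, centralGaussBinom p N n * thetaTerm z p n := by
  -- the first `N` factors of Gauss's product, in reverse order, have the form `1 - z / p ^ (k + 1)`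
  have hreflect : ∏ k ∈ Finset.range N, (1 - z * p ^ (-(N : ℤ)) * p ^ k) =
      ∏ k ∈ Finset.range N, (1 - z * p ^ (-((k + 1 : ℕ) : ℤ))) := by
    rw [← Finset.prod_range_reflect]
    refine Finset.prod_congr rfl fun k hk => ?_
    have hk' := Finset.mem_range.mp hk
    rw [mul_assoc, ← zpow_natCast p (N - 1 - k), ← zpow_add₀ hp0]
    congr 3
    omega
  have hG := prod_one_sub_mul_pow p (z * p ^ (-(N : ℤ))) (2 * N)
  rw [two_mul, Finset.prod_range_add, hreflect] at hG
  have hshift : ∏ k ∈ Finset.range N, (1 - z * p ^ (-(N : ℤ)) * p ^ (N + k)) =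
      ∏ k ∈ Finset.range N, (1 - z * p ^ k) := Finset.prod_congr rfl fun k _ => by
    rw [pow_add, zpow_neg, zpow_natCast]
    field_simp
  rw [hshift, ← two_mul] at hG
  rw [← thetaTerm_neg_mul_prod hz hp0 N, mul_left_comm, mul_comm (∏ k ∈ Finset.range N, _), hG,
    Finset.mul_sum, tsum_eq_sum (s := Finset.Icc (-(N : ℤ)) N) fun n hn => by
      rw [centralGaussBinom, if_neg hn, zero_mul]]
  refine Finset.sum_nbij' (fun j => (j : ℤ) - N) (fun n => (n + N).toNat) ?_ ?_ ?_ ?_ ?_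
  · intro j hj
    rw [Finset.mem_range] at hj
    rw [Finset.mem_Icc]
    omega
  · intro n hn
    rw [Finset.mem_Icc] at hn
    rw [Finset.mem_range]
    omega
  · intro j _
    simp
  · intro n hn
    rw [Finset.mem_Icc] at hn
    omega
  · intro j hj
    rw [Finset.mem_range] at hj
    rw [thetaTerm_sub hz hp0, centralGaussBinom, if_pos (Finset.mem_Icc.mpr (by omega)),
      sub_add_cancel, Int.toNat_natCast]
    ring

lemma qFactorial_ne_zero (hp : ‖p‖ < 1) (k : ℕ) : qFactorial p k ≠ 0 :=
  Finset.prod_ne_zero_iff.mpr fun i _ => one_sub_mul_pow_ne_zero hp hp i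

lemma gaussBinom_add_eq (hp : ‖p‖ < 1) (i j : ℕ) :
    gaussBinom p (i + j) j = qFactorial p (i + j) * ((qFactorial p i)⁻¹ * (qFactorial p j)⁻¹) := by
  rw [← gaussBinom_mul_qFactorial p i j]
  field_simp [qFactorial_ne_zero hp]

lemma centralGaussBinom_eq (hp : ‖p‖ < 1) {N : ℕ} {n : ℤ} (hn : n ∈ Finset.Icc (-(N : ℤ)) N) :
    centralGaussBinom p N n = qFactorial p (2 * N) *
      ((qFactorial p (N - n).toNat)⁻¹ * (qFactorial p (n + N).toNat)⁻¹) := by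
  rw [centralGaussBinom, if_pos hn]
  rw [Finset.mem_Icc] at hn
  rw [show 2 * N = (N - n).toNat + (n + N).toNat by omega, gaussBinom_add_eq hp]

lemma tendsto_qFactorial (hp : ‖p‖ < 1) :
    Tendsto (qFactorial p) atTop (𝓝 (qPochhammerInf p p)) := tendsto_prod_qPochhammerInf p hp

lemma tendsto_centralGaussBinom (hp : ‖p‖ < 1) (n : ℤ) :
    Tendsto (fun N => centralGaussBinom p N n) atTop (𝓝 (qPochhammerInf p p)⁻¹) := by
  have h0 := qPochhammerInf_ne_zero hp hp
  have hq := tendsto_qFactorial hp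
  have t1 : Tendsto (fun N : ℕ => 2 * N) atTop atTop :=
    tendsto_atTop_mono (fun N => by change N ≤ 2 * N; omega) tendsto_id
  have t2 : Tendsto (fun N : ℕ => ((N : ℤ) - n).toNat) atTop atTop :=
    tendsto_atTop.mpr fun b => by
      filter_upwards [eventually_ge_atTop (b + n.natAbs)] with N hN
      omega
  have t3 : Tendsto (fun N : ℕ => (n + (N : ℤ)).toNat) atTop atTop :=
    tendsto_atTop.mpr fun b => by
      filter_upwards [eventually_ge_atTop (b + n.natAbs)] with N hN
      omega
  have h := (hq.comp t1).mul (((hq.inv₀ h0).comp t2).mul ((hq.inv₀ h0).comp t3))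
  rw [mul_inv_cancel_left₀ h0] at h
  refine h.congr' ?_
  filter_upwards [eventually_ge_atTop n.natAbs] with N hN
  rw [centralGaussBinom_eq hp (Finset.mem_Icc.mpr (by omega))]
  rfl

lemma exists_norm_centralGaussBinom_le (hp : ‖p‖ < 1) :
    ∃ K : ℝ, ∀ N n, ‖centralGaussBinom p N n‖ ≤ K := by
  have hq := tendsto_qFactorial hp
  obtain ⟨A, hA⟩ := hq.norm.bddAbove_range
  obtain ⟨B, hB⟩ := (hq.inv₀ (qPochhammerInf_ne_zero hp hp)).norm.bddAbove_range
  have hA' : ∀ k, ‖qFactorial p k‖ ≤ A := fun k => hA ⟨k, rfl⟩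
  have hB' : ∀ k, ‖(qFactorial p k)⁻¹‖ ≤ B := fun k => hB ⟨k, rfl⟩
  have hA0 : 0 ≤ A := (norm_nonneg _).trans (hA' 0)
  have hB0 : 0 ≤ B := (norm_nonneg _).trans (hB' 0)
  refine ⟨A * (B * B), fun N n => ?_⟩
  by_cases hn : n ∈ Finset.Icc (-(N : ℤ)) N
  · rw [centralGaussBinom_eq hp hn, norm_mul, norm_mul]
    exact mul_le_mul (hA' _) (mul_le_mul (hB' _) (hB' _) (norm_nonneg _) hB0)
      (by positivity) hA0
  · rw [centralGaussBinom, if_neg hn, norm_zero]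
    positivity

/-- The Jacobi triple product identity. -/
theorem hasSum_thetaTerm {z : ℂ} (hz : z ≠ 0) (hp0 : p ≠ 0) (hp : ‖p‖ < 1) :
    HasSum (thetaTerm z p)
      (qPochhammerInf z p * qPochhammerInf (p / z) p * qPochhammerInf p p) := by
  have h0 := qPochhammerInf_ne_zero hp hp
  have hs := summable_thetaTerm hz hp0 hp
  obtain ⟨K, hK⟩ := exists_norm_centralGaussBinom_le hp
  have hlim := tendsto_tsum_of_dominated_convergence (𝓕 := atTop)
    (f := fun N n => centralGaussBinom p N n * thetaTerm z p n)
    (g := fun n => (qPochhammerInf p p)⁻¹ * thetaTerm z p n) (hs.norm.mul_left K)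
    (fun n => (tendsto_centralGaussBinom hp n).mul_const _)
    (Eventually.of_forall fun N n => by
      rw [norm_mul]; exact mul_le_mul_of_nonneg_right (hK N n) (norm_nonneg _))
  simp_rw [← finite_triple_product hz hp0] at hlim
  have huniq := tendsto_nhds_unique hlim
    ((tendsto_prod_qPochhammerInf z hp).mul (tendsto_prod_qPochhammerInf (p / z) hp))
  rw [tsum_mul_left] at huniq
  rw [← huniq, mul_comm, mul_inv_cancel_left₀ h0]
  exact hs.hasSum

end

/-! ### The dissection of a product of two theta functions -/

/-- First coordinates of the coset representatives `0, ±e₁, ±e₂` of the lattice spanned by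
`(1, 2)` and `(2, -1)`. -/
def cosetRepFst : Fin 5 → ℤ := ![0, 1, -1, 0, 0]

/-- Second coordinates of the coset representatives `0, ±e₁, ±e₂` of the lattice spanned by
`(1, 2)` and `(2, -1)`. -/
def cosetRepSnd : Fin 5 → ℤ := ![0, 0, 0, 1, -1]

/-- The index in `cosetRepFst`, `cosetRepSnd` of the coset of `(m, n)`, which is determined by
`m + 2 n` modulo `5`. -/
def cosetIndex (m n : ℤ) : Fin 5 :=
  if (m + 2 * n) % 5 = 0 then 0 else if (m + 2 * n) % 5 = 1 then 1 else
  if (m + 2 * n) % 5 = 4 then 2 else if (m + 2 * n) % 5 = 2 then 3 else 4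

/-- The decomposition of `ℤ × ℤ` into the five cosets of the lattice of index `5` with orthogonal
basis `(1, 2)`, `(2, -1)`. -/
def cosetEquiv : Fin 5 × (ℤ × ℤ) ≃ ℤ × ℤ where
  toFun x := (x.2.1 + 2 * x.2.2 + cosetRepFst x.1, 2 * x.2.1 - x.2.2 + cosetRepSnd x.1)
  invFun y := (cosetIndex y.1 y.2,
    ((y.1 - cosetRepFst (cosetIndex y.1 y.2)) + 2 * (y.2 - cosetRepSnd (cosetIndex y.1 y.2))) / 5,
    (2 * (y.1 - cosetRepFst (cosetIndex y.1 y.2)) - (y.2 - cosetRepSnd (cosetIndex y.1 y.2))) / 5)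
  left_inv := by
    rintro ⟨i, k, l⟩
    have h : cosetIndex (k + 2 * l + cosetRepFst i) (2 * k - l + cosetRepSnd i) = i := by
      have hm : (k + 2 * l + cosetRepFst i + 2 * (2 * k - l + cosetRepSnd i)) % 5 =
          (cosetRepFst i + 2 * cosetRepSnd i) % 5 := by omega
      rw [cosetIndex, hm]
      fin_cases i <;> rfl
    simp only [h, Prod.mk.injEq, true_and]
    constructor <;> omega
  right_inv := by
    rintro ⟨m, n⟩
    have h : (m - cosetRepFst (cosetIndex m n) + 2 * (n - cosetRepSnd (cosetIndex m n))) % 5 =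
        0 := by
      unfold cosetIndex
      split_ifs <;> simp [cosetRepFst, cosetRepSnd] <;> omega
    simp only [Prod.mk.injEq]
    constructor <;> omega

/-- The product form of the theta series `∑ n : ℤ, (-1) ^ n p ^ (n (n - 1) / 2) z ^ n`. -/
noncomputable def theta (z p : ℂ) : ℂ :=
  qPochhammerInf z p * qPochhammerInf (p / z) p * qPochhammerInf p p

lemma theta_one (p : ℂ) : theta 1 p = 0 := by
  have h : qPochhammerInf 1 p = 0 := tprod_of_exists_eq_zero ⟨0, by simp⟩
  simp [theta, h]

lemma theta_div {z p : ℂ} (hp0 : p ≠ 0) : theta (p / z) p = theta z p := by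
  rw [theta, theta, div_div_cancel₀ hp0]
  ring

lemma hasSum_thetaTerm_mul {z₁ z₂ p : ℂ} (h₁ : z₁ ≠ 0) (h₂ : z₂ ≠ 0) (hp0 : p ≠ 0) (hp : ‖p‖ < 1) :
    HasSum (fun x : ℤ × ℤ => thetaTerm z₁ p x.1 * thetaTerm z₂ p x.2)
      (theta z₁ p * theta z₂ p) := by
  have s₁ := hasSum_thetaTerm h₁ hp0 hp
  have s₂ := hasSum_thetaTerm h₂ hp0 hp
  exact s₁.mul s₂ (summable_mul_of_summable_norm s₁.summable.norm s₂.summable.norm)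

/-- On each coset the double theta series for `θ(q; q^5) θ(q^2; q^5)` is again a product of theta
terms, because the basis `(1, 2)`, `(2, -1)` is orthogonal. -/
lemma thetaTerm_coset {q : ℂ} (hq0 : q ≠ 0) (i : Fin 5) (k l : ℤ) :
    thetaTerm q (q ^ 5) (k + 2 * l + cosetRepFst i) *
        thetaTerm (q ^ 2) (q ^ 5) (2 * k - l + cosetRepSnd i) =
      (![1, -q, -q ^ 4, -q ^ 2, -q ^ 3] i) *
        (thetaTerm (q ^ (![10, 15, 5, 20, 0] i)) (q ^ 25) k *
          thetaTerm (q ^ (![10, 20, 0, 5, 15] i)) (q ^ 25) l) := by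
  have hterm : ∀ (c d : ℕ) (n : ℤ), thetaTerm (q ^ c) (q ^ d) n =
      (-1) ^ n * q ^ (d * (n * (n - 1) / 2) + c * n) := fun c d n => by
    rw [thetaTerm, ← zpow_natCast q c, ← zpow_natCast q d, ← zpow_mul, ← zpow_mul, mul_assoc,
      ← zpow_add₀ hq0]
  have h1 := hterm 1 5
  rw [pow_one] at h1
  have hneg : ∀ m n : ℤ, Even (m - n) → (-1 : ℂ) ^ m = (-1) ^ n := fun m n h => by
    rw [show m = n + (m - n) by ring, zpow_add₀ (by norm_num), h.neg_one_zpow, mul_one]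
  have hcombine : ∀ (m n k l s e₁ e₂ e₃ e₄ e : ℤ), Even (m + n - (k + l + s)) →
      2 * (e₁ + e₂) = 2 * (e + e₃ + e₄) →
      ((-1) ^ m * q ^ e₁) * ((-1) ^ n * q ^ e₂) =
        ((-1) ^ s * q ^ e) * (((-1) ^ k * q ^ e₃) * ((-1) ^ l * q ^ e₄)) := by
    intro m n k l s e₁ e₂ e₃ e₄ e hs he
    have he' : e₁ + e₂ = e + e₃ + e₄ := by linarith
    have h3 : (-1 : ℂ) ^ m * (-1) ^ n = (-1) ^ k * (-1) ^ l * (-1) ^ s := by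
      rw [← zpow_add₀ (by norm_num), ← zpow_add₀ (by norm_num), ← zpow_add₀ (by norm_num)]
      exact hneg _ _ hs
    have h4 : q ^ e₁ * q ^ e₂ = q ^ e * q ^ e₃ * q ^ e₄ := by
      rw [← zpow_add₀ hq0, ← zpow_add₀ hq0, ← zpow_add₀ hq0, he']
    calc _ = ((-1 : ℂ) ^ m * (-1) ^ n) * (q ^ e₁ * q ^ e₂) := by ring
      _ = _ := by rw [h3, h4]; ring
  have hexp : ∀ n : ℤ, 2 * (n * (n - 1) / 2) = n * (n - 1) := two_mul_triangle
  rw [h1, hterm]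
  have hcoef : (![1, -q, -q ^ 4, -q ^ 2, -q ^ 3] i) =
      (-1) ^ (cosetRepFst i + cosetRepSnd i) * q ^ (![0, 1, 4, 2, 3] i : ℤ) := by
    fin_cases i <;> simp [cosetRepFst, cosetRepSnd]
  rw [hcoef, hterm, hterm]
  apply hcombine
  · rw [show (k + 2 * l + cosetRepFst i) + (2 * k - l + cosetRepSnd i) -
      (k + l + (cosetRepFst i + cosetRepSnd i)) = 2 * k by ring]
    exact even_two_mul k
  · have e1 := hexp (k + 2 * l + cosetRepFst i)
    have e2 := hexp (2 * k - l + cosetRepSnd i)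
    have e3 := hexp k
    have e4 := hexp l
    push_cast
    generalize (k + 2 * l + cosetRepFst i) * (k + 2 * l + cosetRepFst i - 1) / 2 = t₁ at e1 ⊢
    generalize (2 * k - l + cosetRepSnd i) * (2 * k - l + cosetRepSnd i - 1) / 2 = t₂ at e2 ⊢
    generalize k * (k - 1) / 2 = t₃ at e3 ⊢
    generalize l * (l - 1) / 2 = t₄ at e4 ⊢
    fin_cases i <;> simp [cosetRepFst, cosetRepSnd] at e1 e2 ⊢ <;>
      linarith

/-- The dissection of `θ(q; q^5) θ(q^2; q^5)` modulo `5`. -/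
lemma theta_mul_theta {q : ℂ} (hq0 : q ≠ 0) (hq : ‖q‖ < 1) :
    theta q (q ^ 5) * theta (q ^ 2) (q ^ 5) =
      theta (q ^ 10) (q ^ 25) ^ 2 - q * (theta (q ^ 5) (q ^ 25) * theta (q ^ 10) (q ^ 25)) -
        q ^ 2 * theta (q ^ 5) (q ^ 25) ^ 2 := by
  have hS := hasSum_thetaTerm_mul hq0 (pow_ne_zero 2 hq0) (pow_ne_zero 5 hq0)
    (norm_pow_lt_one_of_pos hq (by norm_num : 0 < 5))
  rw [← cosetEquiv.hasSum_iff] at hS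
  have hfib : ∀ i : Fin 5, HasSum (fun x : ℤ × ℤ =>
      ((fun x : ℤ × ℤ => thetaTerm q (q ^ 5) x.1 * thetaTerm (q ^ 2) (q ^ 5) x.2) ∘ cosetEquiv)
        (i, x))
      ((![1, -q, -q ^ 4, -q ^ 2, -q ^ 3] i) *
        (theta (q ^ (![10, 15, 5, 20, 0] i)) (q ^ 25) *
          theta (q ^ (![10, 20, 0, 5, 15] i)) (q ^ 25))) := fun i => by
    refine ((hasSum_thetaTerm_mul (pow_ne_zero _ hq0) (pow_ne_zero _ hq0) (pow_ne_zero 25 hq0)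
      (norm_pow_lt_one_of_pos hq (by norm_num : 0 < 25))).mul_left _).congr_fun fun x => ?_
    exact thetaTerm_coset hq0 i x.1 x.2
  have huniq := (hS.prod_fiberwise hfib).unique (hasSum_fintype _)
  have h15 : theta (q ^ 15) (q ^ 25) = theta (q ^ 10) (q ^ 25) := by
    rw [← theta_div (pow_ne_zero 25 hq0), div_eq_mul_inv, ← pow_sub₀ _ hq0 (by norm_num)]
  have h20 : theta (q ^ 20) (q ^ 25) = theta (q ^ 5) (q ^ 25) := by
    rw [← theta_div (pow_ne_zero 25 hq0), div_eq_mul_inv, ← pow_sub₀ _ hq0 (by norm_num)]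
  rw [huniq]
  simp [Fin.sum_univ_succ, h15, h20, theta_one]
  ring

/-! ### The relations between `R(q)`, `R(q^5)` and Euler's product -/

lemma rogersRamanujanR_eq (q : ℂ) : rogersRamanujanR q =
    (qPochhammerInf (q ^ 1) (q ^ 5) * qPochhammerInf (q ^ 4) (q ^ 5)) /
      (qPochhammerInf (q ^ 2) (q ^ 5) * qPochhammerInf (q ^ 3) (q ^ 5)) := by
  rw [rogersRamanujanR, pow_one]

/-- The product `(q, q^2, q^3, q^4; q^5)_∞`, that is `(q; q)_∞ / (q^5; q^5)_∞`. -/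
noncomputable def eulerQuotient (q : ℂ) : ℂ :=
  qPochhammerInf (q ^ 1) (q ^ 5) * qPochhammerInf (q ^ 2) (q ^ 5) *
    (qPochhammerInf (q ^ 3) (q ^ 5) * qPochhammerInf (q ^ 4) (q ^ 5))

section

variable {q : ℂ}

lemma qPochhammerInf_pow_ne_zero (hq : ‖q‖ < 1) {c : ℕ} (hc : 0 < c) :
    qPochhammerInf (q ^ c) (q ^ 5) ≠ 0 :=
  qPochhammerInf_ne_zero (norm_pow_lt_one_of_pos hq hc) (norm_pow_lt_one_of_pos hq (by norm_num))

lemma rogersRamanujanR_ne_zero (hq : ‖q‖ < 1) : rogersRamanujanR q ≠ 0 := by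
  rw [rogersRamanujanR_eq]
  exact div_ne_zero
    (mul_ne_zero (qPochhammerInf_pow_ne_zero hq (by norm_num))
      (qPochhammerInf_pow_ne_zero hq (by norm_num)))
    (mul_ne_zero (qPochhammerInf_pow_ne_zero hq (by norm_num))
      (qPochhammerInf_pow_ne_zero hq (by norm_num)))

lemma eulerQuotient_ne_zero (hq : ‖q‖ < 1) : eulerQuotient q ≠ 0 :=
  mul_ne_zero
    (mul_ne_zero (qPochhammerInf_pow_ne_zero hq (by norm_num))
      (qPochhammerInf_pow_ne_zero hq (by norm_num)))
    (mul_ne_zero (qPochhammerInf_pow_ne_zero hq (by norm_num))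
      (qPochhammerInf_pow_ne_zero hq (by norm_num)))

lemma qPochhammerInf_self_eq (hq : ‖q‖ < 1) :
    qPochhammerInf q q = eulerQuotient q * qPochhammerInf (q ^ 5) (q ^ 5) := by
  have hq5 : ‖q ^ 5‖ < 1 := norm_pow_lt_one_of_pos hq (by norm_num)
  have hl : Tendsto (fun N => ∏ k ∈ Finset.range (5 * N), (1 - q * q ^ k)) atTop
      (𝓝 (qPochhammerInf q q)) :=
    (tendsto_prod_qPochhammerInf q hq).comp
      (tendsto_atTop_mono (fun N => by change N ≤ 5 * N; omega) tendsto_id)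
  have hr : ∀ c, Tendsto (fun N => ∏ k ∈ Finset.range N, (1 - q ^ c * (q ^ 5) ^ k)) atTop
      (𝓝 (qPochhammerInf (q ^ c) (q ^ 5))) := fun c => tendsto_prod_qPochhammerInf _ hq5
  refine tendsto_nhds_unique hl (((((hr 1).mul (hr 2)).mul ((hr 3).mul (hr 4))).mul
    (hr 5)).congr fun N => ?_)
  induction N with
  | zero => simp
  | succ N ih =>
    rw [show 5 * (N + 1) = 5 * N + 1 + 1 + 1 + 1 + 1 by ring]
    simp only [Finset.prod_range_succ, ← ih]
    ring

lemma qPochhammerInf_zero_left (p : ℂ) : qPochhammerInf 0 p = 1 := by simp [qPochhammerInf]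

@[simp] lemma rogersRamanujanR_zero : rogersRamanujanR 0 = 1 := by
  simp [rogersRamanujanR, qPochhammerInf_zero_left]

@[simp] lemma eulerQuotient_zero : eulerQuotient 0 = 1 := by
  simp [eulerQuotient, qPochhammerInf_zero_left]

/-- Ramanujan's `1 / R(q^5) - q - q^2 R(q^5) = (q; q)_∞ / (q^25; q^25)_∞`, cleared of
denominators. -/
lemma one_sub_sub_eq (hq : ‖q‖ < 1) :
    1 - q * rogersRamanujanR (q ^ 5) - (q * rogersRamanujanR (q ^ 5)) ^ 2 =
      rogersRamanujanR (q ^ 5) * (eulerQuotient q * eulerQuotient (q ^ 5)) := by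
  rcases eq_or_ne q 0 with rfl | hq0
  · simp
  have hq5 : ‖q ^ 5‖ < 1 := norm_pow_lt_one_of_pos hq (by norm_num)
  have hq25 : ‖q ^ 25‖ < 1 := norm_pow_lt_one_of_pos hq (by norm_num)
  -- the theta functions are the numerators and denominators of `R(q)`, `R(q^5)`
  -- times `(q^5; q^5)_∞`, `(q^25; q^25)_∞`
  have h := theta_mul_theta hq0 hq
  have hE := qPochhammerInf_self_eq hq5
  simp only [theta] at h
  rw [show q ^ 5 / q = q ^ 4 by field_simp, show q ^ 5 / q ^ 2 = q ^ 3 by field_simp,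
    show q ^ 25 / q ^ 10 = q ^ 15 by field_simp,
    show q ^ 25 / q ^ 5 = q ^ 20 by field_simp, hE] at h
  simp only [rogersRamanujanR_eq, eulerQuotient, ← pow_mul, Nat.reduceMul] at h ⊢
  have hn : ∀ c : ℕ, 0 < c → qPochhammerInf (q ^ (5 * c)) (q ^ 25) ≠ 0 := fun c hc =>
    qPochhammerInf_ne_zero (norm_pow_lt_one_of_pos hq (by omega)) hq25
  have n1 := hn 1 (by norm_num)
  have n2 := hn 2 (by norm_num)
  have n3 := hn 3 (by norm_num)
  have n4 := hn 4 (by norm_num)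
  have n5 := hn 5 (by norm_num)
  norm_num at n1 n2 n3 n4 n5
  rw [pow_one] at *
  field_simp
  apply mul_right_cancel₀ (pow_ne_zero 2 n5)
  linear_combination -h

lemma prod_one_sub_root_mul {ζ : ℂ} (hζ : IsPrimitiveRoot ζ 5) (x : ℂ) :
    ∏ j ∈ Finset.range 5, (1 - ζ ^ j * x) = 1 - x ^ 5 := by
  have h5 := hζ.pow_eq_one
  have hs := hζ.geom_sum_eq_zero (by norm_num)
  simp only [Finset.prod_range_succ, Finset.sum_range_succ, Finset.prod_range_zero,
    Finset.sum_range_zero] at hs ⊢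
  linear_combination (-x + x ^ 2 * (ζ + ζ ^ 3) - x ^ 3 * (ζ ^ 3 + ζ ^ 5) + x ^ 4 * ζ ^ 6) * hs -
    x ^ 5 * (ζ ^ 5 + 1) * h5

lemma norm_root_mul {ζ : ℂ} (hζ : IsPrimitiveRoot ζ 5) (j : ℕ) (q : ℂ) : ‖ζ ^ j * q‖ = ‖q‖ := by
  rw [norm_mul, norm_pow, Complex.norm_eq_one_of_pow_eq_one hζ.pow_eq_one (by norm_num), one_pow,
    one_mul]

lemma prod_qPochhammerInf_root {ζ : ℂ} (hζ : IsPrimitiveRoot ζ 5) (hq : ‖q‖ < 1) {c : ℕ}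
    (hc : c.Coprime 5) :
    ∏ j ∈ Finset.range 5, qPochhammerInf ((ζ ^ j * q) ^ c) ((ζ ^ j * q) ^ 5) =
      qPochhammerInf ((q ^ 5) ^ c) ((q ^ 5) ^ 5) := by
  have hp : ∀ j, ‖(ζ ^ j * q) ^ 5‖ < 1 := fun j =>
    norm_pow_lt_one_of_pos ((norm_root_mul hζ j q).trans_lt hq) (by norm_num)
  simp only [qPochhammerInf]
  rw [← Multipliable.tprod_finsetProd fun j _ => multipliable_one_sub_mul_pow _ (hp j)]
  refine tprod_congr fun k => ?_
  rw [show (q ^ 5) ^ c * ((q ^ 5) ^ 5) ^ k = (q ^ c * (q ^ 5) ^ k) ^ 5 by ring,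
    ← prod_one_sub_root_mul (hζ.pow_of_coprime c hc)]
  refine Finset.prod_congr rfl fun j _ => ?_
  have h : (ζ ^ j * q) ^ 5 = q ^ 5 := by
    rw [mul_pow, ← pow_mul, mul_comm j, pow_mul, hζ.pow_eq_one, one_pow, one_mul]
  rw [h, mul_pow, ← pow_mul, ← pow_mul, mul_comm j c]
  ring

lemma prod_eulerQuotient_root {ζ : ℂ} (hζ : IsPrimitiveRoot ζ 5) (hq : ‖q‖ < 1) :
    ∏ j ∈ Finset.range 5, eulerQuotient (ζ ^ j * q) = eulerQuotient (q ^ 5) := by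
  simp only [eulerQuotient]
  rw [Finset.prod_mul_distrib, Finset.prod_mul_distrib, Finset.prod_mul_distrib,
    prod_qPochhammerInf_root hζ hq (by norm_num), prod_qPochhammerInf_root hζ hq (by norm_num),
    prod_qPochhammerInf_root hζ hq (by norm_num), prod_qPochhammerInf_root hζ hq (by norm_num)]

/-- The norm of `1 - x - x^2` over the fifth roots of unity; `11` is the fifth Lucas number, the sum
of the fifth powers of the roots of `t^2 = t + 1`. -/
lemma prod_one_sub_sub_root {ζ : ℂ} (hζ : IsPrimitiveRoot ζ 5) (x : ℂ) :
    ∏ j ∈ Finset.range 5, (1 - ζ ^ j * x - (ζ ^ j * x) ^ 2) = 1 - 11 * x ^ 5 - (x ^ 5) ^ 2 := by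
  -- `s = √5`, so `(1 ± s) / 2` are the roots of `t ^ 2 = t + 1`
  obtain ⟨s, hs⟩ := IsAlgClosed.exists_pow_nat_eq (5 : ℂ) (n := 2) (by norm_num)
  have hf : ∀ j, 1 - ζ ^ j * x - (ζ ^ j * x) ^ 2 =
      (1 - ζ ^ j * ((1 + s) / 2 * x)) * (1 - ζ ^ j * ((1 - s) / 2 * x)) := fun j => by
    linear_combination (ζ ^ j * x) ^ 2 / 4 * hs
  simp_rw [hf]
  rw [Finset.prod_mul_distrib, prod_one_sub_root_mul hζ, prod_one_sub_root_mul hζ]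
  have ha : ((1 + s) / 2) ^ 5 = (11 + 5 * s) / 2 := by
    linear_combination (s ^ 3 / 32 + 5 * s ^ 2 / 32 + 15 * s / 32 + 35 / 32) * hs
  have hb : ((1 - s) / 2) ^ 5 = (11 - 5 * s) / 2 := by
    linear_combination (-s ^ 3 / 32 + 5 * s ^ 2 / 32 - 15 * s / 32 + 35 / 32) * hs
  rw [mul_pow, mul_pow, ha, hb]
  linear_combination -(25 / 4) * (x ^ 5) ^ 2 * hs

/-- Ramanujan's `1 / R^5(q) - 11 q - q^2 R^5(q) = ((q; q)_∞ / (q^5; q^5)_∞)^6`, cleared of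
denominators. It is the norm of the identity `one_sub_sub_eq` over the fifth roots of unity. -/
lemma one_sub_eleven_mul_eq (hq : ‖q‖ < 1) :
    1 - 11 * (q * rogersRamanujanR q ^ 5) - (q * rogersRamanujanR q ^ 5) ^ 2 =
      rogersRamanujanR q ^ 5 * eulerQuotient q ^ 6 := by
  -- the norm from `u` to `u ^ 5` gives the identity at `u ^ 5`, and every `q` is a fifth power
  obtain ⟨u, rfl⟩ := IsAlgClosed.exists_pow_nat_eq q (n := 5) (by norm_num)
  have hu : ‖u‖ < 1 := by
    rw [norm_pow] at hq
    exact (pow_lt_one_iff_of_nonneg (norm_nonneg _) (by norm_num)).mp hq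
  have hζ := Complex.isPrimitiveRoot_exp 5 (by norm_num)
  set ζ := Complex.exp (2 * Real.pi * Complex.I / (5 : ℕ))
  have h5 : ∀ j, (ζ ^ j * u) ^ 5 = u ^ 5 := fun j => by
    rw [mul_pow, ← pow_mul, mul_comm j, pow_mul, hζ.pow_eq_one, one_pow, one_mul]
  have hj : ∀ j ∈ Finset.range 5,
      1 - ζ ^ j * (u * rogersRamanujanR (u ^ 5)) - (ζ ^ j * (u * rogersRamanujanR (u ^ 5))) ^ 2 =
      rogersRamanujanR (u ^ 5) * (eulerQuotient (ζ ^ j * u) * eulerQuotient (u ^ 5)) :=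
    fun j _ => by
      have := one_sub_sub_eq ((norm_root_mul hζ j u).trans_lt hu)
      rw [h5 j] at this
      rw [← this]
      ring
  have h := Finset.prod_congr rfl hj
  rw [prod_one_sub_sub_root hζ, Finset.prod_mul_distrib, Finset.prod_mul_distrib,
    prod_eulerQuotient_root hζ hu, Finset.prod_const, Finset.prod_const, Finset.card_range] at h
  linear_combination h

end

/-! ### The modular equation of degree 5 -/

section

open PowerSeries

/-- The expansion of `R(q)`. -/
noncomputable def rogersSeries : PowerSeries ℝ :=
  residueSeries 1 * residueSeries 4 * (residueSeriesInv 2 * residueSeriesInv 3)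

/-- The expansion of `1 / R(q)`. -/
noncomputable def rogersSeriesInv : PowerSeries ℝ :=
  residueSeries 2 * residueSeries 3 * (residueSeriesInv 1 * residueSeriesInv 4)

/-- The expansion of `(q^5; q^5)_∞ / (q; q)_∞`, the generating function of partitions into parts
not divisible by `5`. -/
noncomputable def eulerQuotientInvSeries : PowerSeries ℝ :=
  residueSeriesInv 1 * residueSeriesInv 4 * (residueSeriesInv 2 * residueSeriesInv 3)

lemma expands_rogersRamanujanR : Expands rogersRamanujanR rogersSeries := by
  refine (((expands_residueSeries (c := 1) (by norm_num)).mul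
    (expands_residueSeries (c := 4) (by norm_num))).mul
    ((expands_residueSeriesInv (c := 2) (by norm_num)).mul
      (expands_residueSeriesInv (c := 3) (by norm_num)))).congr fun q _ => ?_
  rw [rogersRamanujanR_eq, div_eq_mul_inv, mul_inv]

lemma expands_rogersRamanujanR_inv :
    Expands (fun q => (rogersRamanujanR q)⁻¹) rogersSeriesInv := by
  refine (((expands_residueSeries (c := 2) (by norm_num)).mul
    (expands_residueSeries (c := 3) (by norm_num))).mul
    ((expands_residueSeriesInv (c := 1) (by norm_num)).mul
      (expands_residueSeriesInv (c := 4) (by norm_num)))).congr fun q _ => ?_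
  rw [rogersRamanujanR_eq, inv_div, div_eq_mul_inv, mul_inv]

lemma expands_eulerQuotient_inv :
    Expands (fun q => (eulerQuotient q)⁻¹) eulerQuotientInvSeries := by
  refine (((expands_residueSeriesInv (c := 1) (by norm_num)).mul
    (expands_residueSeriesInv (c := 4) (by norm_num))).mul
    ((expands_residueSeriesInv (c := 2) (by norm_num)).mul
      (expands_residueSeriesInv (c := 3) (by norm_num)))).congr fun q _ => ?_
  simp only [eulerQuotient, mul_inv]
  ring

/-- The numerator of Ramanujan's modular equation of degree `5`:
`R(q)^5 = R(q^5) M(w) / N(w)` with `w = q R(q^5)`. -/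
def modularNum (w : ℂ) : ℂ := 1 - 2 * w + 4 * w ^ 2 - 3 * w ^ 3 + w ^ 4

/-- The denominator of Ramanujan's modular equation of degree `5`. -/
def modularDen (w : ℂ) : ℂ := 1 + 3 * w + 4 * w ^ 2 + 2 * w ^ 3 + w ^ 4

lemma modularNum_mul_modularDen (w : ℂ) :
    modularNum w * modularDen w * (1 - w - w ^ 2) = 1 - 11 * w ^ 5 - (w ^ 5) ^ 2 := by
  rw [modularNum, modularDen]; ring

lemma modularNum_mul_modularDen_eq {q : ℂ} (hq : ‖q‖ < 1) :
    modularNum (q * rogersRamanujanR (q ^ 5)) * modularDen (q * rogersRamanujanR (q ^ 5)) *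
        eulerQuotient q =
      rogersRamanujanR (q ^ 5) ^ 4 * eulerQuotient (q ^ 5) ^ 5 := by
  have hq5 : ‖q ^ 5‖ < 1 := norm_pow_lt_one_of_pos hq (by norm_num)
  have h1 := modularNum_mul_modularDen (q * rogersRamanujanR (q ^ 5))
  have h2 := one_sub_eleven_mul_eq hq5
  rw [one_sub_sub_eq hq, mul_pow, h2] at h1
  apply mul_right_cancel₀ (mul_ne_zero (rogersRamanujanR_ne_zero hq5) (eulerQuotient_ne_zero hq5))
  linear_combination h1

/-- Ramanujan's modular equation of degree `5`. Both `t = q R(q)^5` and `t = w M(w) / N(w)` are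
roots of the quadratic equation `w M(w) N(w) (1 - 11 t - t^2) = (1 - w - w^2)^5 t`; the other root
`-N(w) / (w M(w))` is excluded near `q = 0`, hence on the whole disc by the identity theorem. -/
lemma rogersRamanujanR_pow_five {q : ℂ} (hq : ‖q‖ < 1) :
    rogersRamanujanR q ^ 5 * modularDen (q * rogersRamanujanR (q ^ 5)) =
      rogersRamanujanR (q ^ 5) * modularNum (q * rogersRamanujanR (q ^ 5)) := by
  set F : ℂ → ℂ := fun q => rogersRamanujanR q ^ 5 * modularDen (q * rogersRamanujanR (q ^ 5)) -
    rogersRamanujanR (q ^ 5) * modularNum (q * rogersRamanujanR (q ^ 5)) with hF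
  set G : ℂ → ℂ := fun q => q * rogersRamanujanR q ^ 5 * (q * rogersRamanujanR (q ^ 5)) *
    modularNum (q * rogersRamanujanR (q ^ 5)) + modularDen (q * rogersRamanujanR (q ^ 5)) with hG
  -- `q F G` is the quadratic polynomial factored at its two roots
  have hFG : ∀ q : ℂ, ‖q‖ < 1 → F q * G q = 0 := by
    intro q hq
    rcases eq_or_ne q 0 with rfl | hq0
    · simp [hF, modularNum, modularDen]
    have h1 := one_sub_eleven_mul_eq hq
    have h2 := modularNum_mul_modularDen_eq hq
    have h3 := one_sub_sub_eq hq
    simp only [hF, hG]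
    set R := rogersRamanujanR q
    set R₅ := rogersRamanujanR (q ^ 5)
    set e := eulerQuotient q
    set e₅ := eulerQuotient (q ^ 5)
    set w := q * R₅ with hw
    have h4 : modularDen w ^ 2 - w ^ 2 * modularNum w ^ 2 - 11 * w * modularNum w * modularDen w =
        (1 - w - w ^ 2) ^ 5 := by
      rw [modularNum, modularDen]; ring
    rw [h3] at h4
    apply mul_left_cancel₀ hq0
    linear_combination q * R ^ 5 * h4 - w * modularNum w * modularDen w * h1 -
      q * R₅ * R ^ 5 * e ^ 5 * h2
  have hR := expands_rogersRamanujanR.differentiableOn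
  have hR5 : DifferentiableOn ℂ (fun q : ℂ => rogersRamanujanR (q ^ 5)) (Metric.ball 0 1) :=
    hR.comp (by fun_prop) fun q hq => by
      rw [mem_ball_zero_iff] at hq ⊢
      exact norm_pow_lt_one_of_pos hq (by norm_num)
  have hFd : DifferentiableOn ℂ F (Metric.ball 0 1) := by
    simp only [hF, modularNum, modularDen]
    fun_prop
  have hGd : DifferentiableOn ℂ G (Metric.ball 0 1) := by
    simp only [hG, modularNum, modularDen]
    fun_prop
  have hball : Metric.ball (0 : ℂ) 1 ∈ 𝓝 0 := Metric.ball_mem_nhds 0 one_pos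
  have hG0 : ∀ᶠ q in 𝓝 0, G q ≠ 0 :=
    (hGd.continuousOn.continuousAt hball).eventually_ne (by simp [hG, modularDen])
  have hF0 : F =ᶠ[𝓝 0] 0 := by
    filter_upwards [hG0, hball] with q hq hqb
    exact (mul_eq_zero.mp (hFG q (mem_ball_zero_iff.mp hqb))).resolve_right hq
  have hzero := (hFd.analyticOnNhd Metric.isOpen_ball).eqOn_zero_of_preconnected_of_eventuallyEq_zero
    (convex_ball (0 : ℂ) 1).isPreconnected (Metric.mem_ball_self one_pos) hF0
  exact sub_eq_zero.mp (hzero (mem_ball_zero_iff.mpr hq))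

end

/-! ### The dissections modulo 5 -/

section

open PowerSeries

lemma expands_monomial (c : ℝ) (k i j : ℕ) :
    Expands (fun q => (c : ℂ) * (q ^ k * (rogersRamanujanR q)⁻¹ ^ i * rogersRamanujanR q ^ j *
      (eulerQuotient q)⁻¹ ^ 6))
      (C c * (X ^ k * rogersSeriesInv ^ i * rogersSeries ^ j * eulerQuotientInvSeries ^ 6)) :=
  ((((Expands.id.pow k).mul (expands_rogersRamanujanR_inv.pow i)).mul
    (expands_rogersRamanujanR.pow j)).mul (expands_eulerQuotient_inv.pow 6)).const_mul c

/-- The two terms of exponents `r` and `r + 5` in the dissections below: up to the factor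
`((q^5; q^5)_∞ / (q; q)_∞)^6` a combination of two monomials in `q`, `R(q)` and `1 / R(q)`. -/
noncomputable def dissectionTerm (c d : ℝ) (i j i' j' : ℕ) (q : ℂ) : ℂ :=
  (c : ℂ) * (q ^ 0 * (rogersRamanujanR q)⁻¹ ^ i * rogersRamanujanR q ^ j *
      (eulerQuotient q)⁻¹ ^ 6) +
    (d : ℂ) * (q ^ 1 * (rogersRamanujanR q)⁻¹ ^ i' * rogersRamanujanR q ^ j' *
      (eulerQuotient q)⁻¹ ^ 6)

lemma exists_expands_dissectionTerm (c d : ℝ) (i j i' j' : ℕ) :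
    ∃ φ, Expands (dissectionTerm c d i j i' j') φ :=
  ⟨_, (expands_monomial c 0 i j).add (expands_monomial d 1 i' j')⟩

/-- A function given by a dissection modulo `5` has an expansion, in which the coefficients in the
residue class of `r₀` are those of the component with index `r₀`. -/
lemma exists_expansion_of_dissection {f : ℂ → ℂ} {h : Fin 5 → ℂ → ℂ} (r₀ : Fin 5)
    {φ₀ : PowerSeries ℝ} (h₀ : Expands (h r₀) φ₀) (hr : ∀ r, ∃ φ, Expands (h r) φ)
    (hf : ∀ q : ℂ, ‖q‖ < 1 → f q = ∑ r : Fin 5, q ^ (r : ℕ) * h r (q ^ 5)) :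
    ∃ a : ℕ → ℝ, HasUnitDiscExpansion f a ∧ ∀ n, a (5 * n + r₀) = coeff n φ₀ := by
  classical
  choose φ hφ using hr
  have hφ' : ∀ r, Expands (h r) (Function.update φ r₀ φ₀ r) := fun r => by
    rcases eq_or_ne r r₀ with rfl | hne
    · rwa [Function.update_self]
    · rw [Function.update_of_ne hne]; exact hφ r
  refine ⟨_, fun q hq => by rw [hf q hq]; exact hasUnitDiscExpansion_dissection hφ' q hq,
    fun n => ?_⟩
  have h1 : Fin.ofNat 5 (5 * n + (r₀ : ℕ)) = r₀ := by
    ext; simp [Fin.ofNat, Nat.mod_eq_of_lt r₀.isLt]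
  have h2 : (5 * n + (r₀ : ℕ)) / 5 = n := by have := r₀.isLt; omega
  rw [h1, h2, Function.update_self]

section

variable {q : ℂ}

/-- The dissection of `R(q)^5` modulo `5`. -/
lemma rogersRamanujanR_pow_five_dissection (hq : ‖q‖ < 1) :
    rogersRamanujanR q ^ 5 = ∑ r : Fin 5, q ^ (r : ℕ) *
      (![fun q => rogersRamanujanR q - 25 * (q * (rogersRamanujanR q * (eulerQuotient q)⁻¹ ^ 6)),
        dissectionTerm (-5) 15 3 0 0 2, dissectionTerm 15 5 2 0 0 3,
        dissectionTerm (-30) (-10) 1 0 0 4, dissectionTerm 40 5 0 0 0 5] : Fin 5 → ℂ → ℂ) r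
        (q ^ 5) := by
  have hq5 : ‖q ^ 5‖ < 1 := norm_pow_lt_one_of_pos hq (by norm_num)
  have hR := rogersRamanujanR_ne_zero hq5
  have he := eulerQuotient_ne_zero hq5
  have h1 := rogersRamanujanR_pow_five hq
  have h2 := one_sub_eleven_mul_eq hq5
  have h3 := modularNum_mul_modularDen (q * rogersRamanujanR (q ^ 5))
  simp [Fin.sum_univ_five, dissectionTerm]
  set R := rogersRamanujanR (q ^ 5)
  set e := eulerQuotient (q ^ 5)
  set w := q * R with hw
  apply mul_left_cancel₀ (mul_ne_zero (pow_ne_zero 5 hR) (pow_ne_zero 6 he))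
  -- the factor `N` of the denominator is absorbed by `M N (1 - w - w ^ 2) = R ^ 5 e ^ 6`
  have h4 : R ^ 5 * e ^ 6 * rogersRamanujanR q ^ 5 = R * modularNum w ^ 2 * (1 - w - w ^ 2) := by
    linear_combination modularNum w * (1 - w - w ^ 2) * h1 - rogersRamanujanR q ^ 5 * h3 -
      rogersRamanujanR q ^ 5 * h2
  rw [h4, modularNum]
  field_simp
  rw [hw]
  linear_combination h2

/-- The dissection of `1 / R(q)^5` modulo `5`. -/
lemma one_div_rogersRamanujanR_pow_five_dissection (hq : ‖q‖ < 1) :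
    1 / rogersRamanujanR q ^ 5 = ∑ r : Fin 5, q ^ (r : ℕ) *
      (![fun q => (rogersRamanujanR q)⁻¹ -
          25 * (q * ((rogersRamanujanR q)⁻¹ * (eulerQuotient q)⁻¹ ^ 6)),
        dissectionTerm 5 (-40) 5 0 0 0, dissectionTerm 10 (-30) 4 0 0 1,
        dissectionTerm 5 (-15) 3 0 0 2, dissectionTerm (-15) (-5) 2 0 0 3] : Fin 5 → ℂ → ℂ) r
        (q ^ 5) := by
  have hq5 : ‖q ^ 5‖ < 1 := norm_pow_lt_one_of_pos hq (by norm_num)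
  have hR := rogersRamanujanR_ne_zero hq5
  have hRq := rogersRamanujanR_ne_zero hq
  have he := eulerQuotient_ne_zero hq5
  have h1 := rogersRamanujanR_pow_five hq
  have h2 := one_sub_eleven_mul_eq hq5
  have h3 := modularNum_mul_modularDen (q * rogersRamanujanR (q ^ 5))
  have h4 : 1 / rogersRamanujanR q ^ 5 * (rogersRamanujanR (q ^ 5) *
      modularNum (q * rogersRamanujanR (q ^ 5))) =
      modularDen (q * rogersRamanujanR (q ^ 5)) := by
    field_simp
    linear_combination -h1
  simp only [Fin.sum_univ_five]
  generalize 1 / rogersRamanujanR q ^ 5 = y at h4 ⊢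
  simp [dissectionTerm]
  set R := rogersRamanujanR (q ^ 5)
  set e := eulerQuotient (q ^ 5)
  set w := q * R with hw
  apply mul_left_cancel₀ (mul_ne_zero (pow_ne_zero 6 hR) (pow_ne_zero 6 he))
  have h5 : R ^ 6 * e ^ 6 * y = modularDen w ^ 2 * (1 - w - w ^ 2) := by
    linear_combination modularDen w * (1 - w - w ^ 2) * h4 - R * y * h3 - R * y * h2
  rw [h5, modularDen]
  field_simp
  rw [hw]
  linear_combination h2

/-- The dissection of `R(q^5) / R(q)^5` modulo `5`. -/
lemma rogersRamanujanR_div_dissection (hq : ‖q‖ < 1) :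
    rogersRamanujanR (q ^ 5) / rogersRamanujanR q ^ 5 = ∑ r : Fin 5, q ^ (r : ℕ) *
      (![fun q => dissectionTerm 1 (-36) 5 0 0 0 q +
          ((-1 : ℝ) : ℂ) * (q ^ 2 * (rogersRamanujanR q)⁻¹ ^ 0 * rogersRamanujanR q ^ 5 *
            (eulerQuotient q)⁻¹ ^ 6),
        fun q => 5 * (rogersRamanujanR q + 3 * (q * (rogersRamanujanR q * (eulerQuotient q)⁻¹ ^ 6)) +
          q ^ 2 * (rogersRamanujanR q * (eulerQuotient q)⁻¹) ^ 6),
        dissectionTerm 10 (-30) 3 0 0 2, dissectionTerm 5 (-15) 2 0 0 3,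
        dissectionTerm (-15) (-5) 1 0 0 4] : Fin 5 → ℂ → ℂ) r (q ^ 5) := by
  have hq5 : ‖q ^ 5‖ < 1 := norm_pow_lt_one_of_pos hq (by norm_num)
  have hR := rogersRamanujanR_ne_zero hq5
  have hRq := rogersRamanujanR_ne_zero hq
  have he := eulerQuotient_ne_zero hq5
  have h1 := rogersRamanujanR_pow_five hq
  have h2 := one_sub_eleven_mul_eq hq5
  have h3 := modularNum_mul_modularDen (q * rogersRamanujanR (q ^ 5))
  have h4 : 1 / rogersRamanujanR q ^ 5 * (rogersRamanujanR (q ^ 5) *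
      modularNum (q * rogersRamanujanR (q ^ 5))) =
      modularDen (q * rogersRamanujanR (q ^ 5)) := by
    field_simp
    linear_combination -h1
  rw [← mul_one_div]
  simp only [Fin.sum_univ_five]
  generalize 1 / rogersRamanujanR q ^ 5 = y at h4 ⊢
  simp [dissectionTerm]
  set R := rogersRamanujanR (q ^ 5)
  set e := eulerQuotient (q ^ 5)
  set w := q * R with hw
  apply mul_left_cancel₀ (mul_ne_zero (pow_ne_zero 5 hR) (pow_ne_zero 6 he))
  have h5 : R ^ 5 * e ^ 6 * (R * y) = modularDen w ^ 2 * (1 - w - w ^ 2) := by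
    linear_combination modularDen w * (1 - w - w ^ 2) * h4 - R * y * h3 - R * y * h2
  rw [h5, modularDen]
  field_simp
  rw [hw]
  linear_combination 5 * q * R * h2

end

end

/-! ### Signs of the coefficients -/

section

open PowerSeries

lemma majorizes_residueIndicator (c : ℕ) : Majorizes (residueIndicator c) (residueIndicator c) :=
  Majorizes.of_nonneg fun n => by
    rw [residueIndicator, coeff_mk]; split_ifs <;> norm_num

/-- The bound `φ ≤ 1 + Q φ` is multiplicative: the bounding series `Q` add up. -/
lemma Majorizes.mul_one_add {φ ψ Q Q' : PowerSeries ℝ} (h : Majorizes φ (1 + Q * φ))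
    (h' : Majorizes ψ (1 + Q' * ψ)) (h1 : Majorizes 1 φ) (hψ : Majorizes ψ ψ)
    (hQ' : Majorizes Q' Q') : Majorizes (φ * ψ) (1 + (Q + Q') * (φ * ψ)) := by
  have e1 : Majorizes (φ * ψ) (ψ + Q * (φ * ψ)) := by
    have := h.mul hψ
    rwa [add_mul, one_mul, mul_assoc] at this
  have e2 : Majorizes ψ (1 + Q' * (φ * ψ)) := by
    refine h'.trans (Majorizes.one.add (hQ'.mul ?_))
    simpa using h1.mul hψ
  have e3 : Majorizes (ψ + Q * (φ * ψ)) (1 + Q' * (φ * ψ) + Q * (φ * ψ)) := fun n => by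
    have a1 := e1.coeff_nonneg n
    rw [abs_of_nonneg a1, map_add, map_add _ (1 + _)]
    exact add_le_add_left ((le_abs_self _).trans (e2 n)) _
  have e4 : 1 + (Q + Q') * (φ * ψ) = 1 + Q' * (φ * ψ) + Q * (φ * ψ) := by ring
  rw [e4]
  exact e1.trans e3

lemma one_majorizes_mul {φ ψ : PowerSeries ℝ} (h : Majorizes 1 φ) (h' : Majorizes 1 ψ) :
    Majorizes 1 (φ * ψ) := by simpa using h.mul h'

lemma one_majorizes_eulerQuotientInvSeries : Majorizes 1 eulerQuotientInvSeries :=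
  one_majorizes_mul
    (one_majorizes_mul (one_majorizes_residueSeriesInv (by norm_num))
      (one_majorizes_residueSeriesInv (by norm_num)))
    (one_majorizes_mul (one_majorizes_residueSeriesInv (by norm_num))
      (one_majorizes_residueSeriesInv (by norm_num)))

lemma mk_one_majorizes_eulerQuotientInvSeries : Majorizes (mk 1) eulerQuotientInvSeries := by
  have h := (mk_one_majorizes_residueSeriesInv.mul
    (one_majorizes_residueSeriesInv (c := 4) (by norm_num))).mul
    (one_majorizes_mul (one_majorizes_residueSeriesInv (c := 2) (by norm_num))
      (one_majorizes_residueSeriesInv (c := 3) (by norm_num)))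
  rwa [mul_one, mul_one] at h

lemma residueIndicator_add_majorizes :
    Majorizes (residueIndicator 1 + residueIndicator 4 + (residueIndicator 2 + residueIndicator 3))
      (X * mk 1) := by
  intro n
  cases n with
  | zero => simp [residueIndicator]
  | succ n =>
    rw [coeff_succ_X_mul]
    simp only [map_add, residueIndicator, coeff_mk, Pi.one_apply]
    split_ifs <;> first | omega | norm_num

/-- Removing a part from a nonempty partition: with `S = (q^5; q^5)_∞ / (q; q)_∞` one has
`S ≤ 1 + q S / (1 - q)` and `1 / (1 - q) ≤ S` coefficientwise. -/
lemma eulerQuotientInvSeries_majorizes :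
    Majorizes eulerQuotientInvSeries
      (1 + X * (eulerQuotientInvSeries * eulerQuotientInvSeries)) := by
  have h : ∀ c, 0 < c → c < 5 →
      Majorizes (residueSeriesInv c) (1 + residueIndicator c * residueSeriesInv c) :=
    fun c => residueSeriesInv_majorizes_one_add
  have h1 : ∀ c, 0 < c → Majorizes 1 (residueSeriesInv c) :=
    fun c => one_majorizes_residueSeriesInv
  have hQ := majorizes_residueIndicator
  have h14 := (h 1 (by norm_num) (by norm_num)).mul_one_add (h 4 (by norm_num) (by norm_num))
    (h1 1 (by norm_num)) (h1 4 (by norm_num)).self_right (hQ 4)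
  have h23 := (h 2 (by norm_num) (by norm_num)).mul_one_add (h 3 (by norm_num) (by norm_num))
    (h1 2 (by norm_num)) (h1 3 (by norm_num)).self_right (hQ 3)
  have hS := h14.mul_one_add h23
    (one_majorizes_mul (h1 1 (by norm_num)) (h1 4 (by norm_num)))
    (one_majorizes_mul (h1 2 (by norm_num)) (h1 3 (by norm_num))).self_right
    ((hQ 2).add (hQ 3))
  refine Majorizes.trans hS (Majorizes.one.add ?_)
  rw [← mul_assoc X]
  have hself := one_majorizes_eulerQuotientInvSeries.self_right
  exact (residueIndicator_add_majorizes.trans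
    (Majorizes.X.mul mk_one_majorizes_eulerQuotientInvSeries)).mul hself

lemma rogersSeries_majorizes : Majorizes rogersSeries eulerQuotientInvSeries :=
  ((residueSeries_majorizes (by norm_num)).mul (residueSeries_majorizes (by norm_num))).mul
    (one_majorizes_mul (one_majorizes_residueSeriesInv (by norm_num))
      (one_majorizes_residueSeriesInv (by norm_num))).self_right

lemma rogersSeriesInv_majorizes : Majorizes rogersSeriesInv eulerQuotientInvSeries := by
  have h := ((residueSeries_majorizes (c := 2) (by norm_num)).mul
    (residueSeries_majorizes (c := 3) (by norm_num))).mul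
    (one_majorizes_mul (one_majorizes_residueSeriesInv (c := 1) (by norm_num))
      (one_majorizes_residueSeriesInv (c := 4) (by norm_num))).self_right
  rw [mul_comm (residueSeriesInv 2 * _)] at h
  exact h

/-- A series bounded by `S = (q^5; q^5)_∞ / (q; q)_∞` is dominated, apart from its constant term,
by `q` times any series above `S^2`. This compares `R(q)` and `1 / R(q)` with their multiples by
`q / e^6`. -/
lemma abs_coeff_succ_le {φ ψ : PowerSeries ℝ} (hφ : Majorizes φ eulerQuotientInvSeries)
    (hψ : Majorizes (eulerQuotientInvSeries * eulerQuotientInvSeries) ψ) (n : ℕ) :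
    |coeff (n + 1) φ| ≤ coeff n ψ := by
  have h := (hφ.trans eulerQuotientInvSeries_majorizes) (n + 1)
  rw [map_add, coeff_one, if_neg n.succ_ne_zero, zero_add, coeff_succ_X_mul] at h
  exact h.trans ((le_abs_self _).trans (hψ n))

lemma one_le_coeff {ψ : PowerSeries ℝ}
    (hψ : Majorizes (eulerQuotientInvSeries * eulerQuotientInvSeries) ψ) (n : ℕ) :
    1 ≤ coeff n ψ := by
  have h := (mk_one_majorizes_eulerQuotientInvSeries.mul one_majorizes_eulerQuotientInvSeries).trans
    hψ n
  simpa using h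

/-- The expansion of `((q^5; q^5)_∞ / (q; q)_∞)^6 / R(q)`, written as a product of series with
nonnegative coefficients. -/
noncomputable def rogersInvMajorant : PowerSeries ℝ :=
  eulerQuotientInvSeries ^ 5 * (residueSeriesInv 1 * residueSeriesInv 4) ^ 2

/-- The expansion of `((q^5; q^5)_∞ / (q; q)_∞)^6 R(q)`, written as a product of series with
nonnegative coefficients. -/
noncomputable def rogersMajorant : PowerSeries ℝ :=
  eulerQuotientInvSeries ^ 5 * (residueSeriesInv 2 * residueSeriesInv 3) ^ 2

lemma majorizes_pow_five_mul_sq {φ : PowerSeries ℝ} (hφ : Majorizes 1 φ) :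
    Majorizes (eulerQuotientInvSeries * eulerQuotientInvSeries)
      (eulerQuotientInvSeries ^ 5 * φ ^ 2) := by
  have h1 := one_majorizes_eulerQuotientInvSeries
  have h := (h1.self_right.mul h1.self_right).mul ((h1.pow 3).mul (hφ.pow 2))
  rw [one_pow, one_pow, mul_one, mul_one] at h
  rwa [show eulerQuotientInvSeries ^ 5 * φ ^ 2 = eulerQuotientInvSeries * eulerQuotientInvSeries *
    (eulerQuotientInvSeries ^ 3 * φ ^ 2) by ring]

lemma majorizes_rogersInvMajorant :
    Majorizes (eulerQuotientInvSeries * eulerQuotientInvSeries) rogersInvMajorant :=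
  majorizes_pow_five_mul_sq (one_majorizes_mul (one_majorizes_residueSeriesInv (by norm_num))
    (one_majorizes_residueSeriesInv (by norm_num)))

lemma majorizes_rogersMajorant :
    Majorizes (eulerQuotientInvSeries * eulerQuotientInvSeries) rogersMajorant :=
  majorizes_pow_five_mul_sq (one_majorizes_mul (one_majorizes_residueSeriesInv (by norm_num))
    (one_majorizes_residueSeriesInv (by norm_num)))

lemma expands_rogersInvMajorant :
    Expands (fun q => (rogersRamanujanR q)⁻¹ * (eulerQuotient q)⁻¹ ^ 6) rogersInvMajorant := by
  refine ((expands_eulerQuotient_inv.pow 5).mul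
    (((expands_residueSeriesInv (c := 1) (by norm_num)).mul
      (expands_residueSeriesInv (c := 4) (by norm_num))).pow 2)).congr fun q hq => ?_
  have h := fun c (hc : 0 < c) => qPochhammerInf_pow_ne_zero (q := q) hq (c := c) hc
  have h1 := h 1 (by norm_num)
  have h2 := h 2 (by norm_num)
  have h3 := h 3 (by norm_num)
  have h4 := h 4 (by norm_num)
  rw [rogersRamanujanR_eq, eulerQuotient]
  field_simp

lemma expands_rogersMajorant :
    Expands (fun q => rogersRamanujanR q * (eulerQuotient q)⁻¹ ^ 6) rogersMajorant := by
  refine ((expands_eulerQuotient_inv.pow 5).mul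
    (((expands_residueSeriesInv (c := 2) (by norm_num)).mul
      (expands_residueSeriesInv (c := 3) (by norm_num))).pow 2)).congr fun q hq => ?_
  have h := fun c (hc : 0 < c) => qPochhammerInf_pow_ne_zero (q := q) hq (c := c) hc
  have h1 := h 1 (by norm_num)
  have h2 := h 2 (by norm_num)
  have h3 := h 3 (by norm_num)
  have h4 := h 4 (by norm_num)
  rw [rogersRamanujanR_eq, eulerQuotient]
  field_simp

lemma expands_rogersRamanujanR_mul_eulerQuotient_inv :
    Expands (fun q => rogersRamanujanR q * (eulerQuotient q)⁻¹)
      ((residueSeriesInv 2 * residueSeriesInv 3) ^ 2) := by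
  refine (((expands_residueSeriesInv (c := 2) (by norm_num)).mul
      (expands_residueSeriesInv (c := 3) (by norm_num))).pow 2).congr fun q hq => ?_
  have h := fun c (hc : 0 < c) => qPochhammerInf_pow_ne_zero (q := q) hq (c := c) hc
  have h1 := h 1 (by norm_num)
  have h2 := h 2 (by norm_num)
  have h3 := h 3 (by norm_num)
  have h4 := h 4 (by norm_num)
  rw [rogersRamanujanR_eq, eulerQuotient]
  rw [pow_one] at h1 ⊢
  field_simp

lemma coeff_zero_rogersSeries : coeff 0 rogersSeries = 1 := by
  have h1 : ∀ c, 0 < c → constantCoeff (residueSeries c) = 1 := fun c hc => by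
    rw [← coeff_zero_eq_constantCoeff_apply, coeff_residueSeries (N := 1) (by norm_num)]
    simp [residueProd, hc.ne']
  have h2 : ∀ c, 0 < c → constantCoeff (residueSeriesInv c) = 1 := fun c hc => by
    rw [← coeff_zero_eq_constantCoeff_apply, coeff_residueSeriesInv hc (N := 1) (by norm_num)]
    simp [residueProdInv, geomSeries]
  rw [coeff_zero_eq_constantCoeff_apply, rogersSeries]
  simp [h1, h2]

end

open PowerSeries in
theorem theorem1 :
    ∃ A B D : ℕ → ℝ,
      HasUnitDiscExpansion (fun q => 1 / rogersRamanujanR q ^ 5) A ∧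
      HasUnitDiscExpansion (fun q => rogersRamanujanR q ^ 5) B ∧
      HasUnitDiscExpansion (fun q => rogersRamanujanR (q ^ 5) / rogersRamanujanR q ^ 5) D ∧
      (∀ n : ℕ, 1 ≤ n → A (5 * n) < 0) ∧
      (∀ n : ℕ, 1 ≤ n → B (5 * n) < 0) ∧
      (∀ n : ℕ, 0 < D (5 * n + 1)) := by
  have hA := expands_rogersRamanujanR_inv.sub
    ((Expands.id.mul expands_rogersInvMajorant).const_mul 25)
  have hB := expands_rogersRamanujanR.sub ((Expands.id.mul expands_rogersMajorant).const_mul 25)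
  have hD := ((expands_rogersRamanujanR.add
    ((Expands.id.mul expands_rogersMajorant).const_mul 3)).add
    ((Expands.id.pow 2).mul (expands_rogersRamanujanR_mul_eulerQuotient_inv.pow 6))).const_mul 5
  push_cast at hA hB hD
  have hterm := exists_expands_dissectionTerm
  obtain ⟨A, hA1, hA2⟩ := exists_expansion_of_dissection 0 hA
    (by
      simp only [Fin.forall_fin_succ]
      exact ⟨⟨_, hA⟩, hterm _ _ _ _ _ _, hterm _ _ _ _ _ _, hterm _ _ _ _ _ _,
        hterm _ _ _ _ _ _, fun i => i.elim0⟩)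
    fun q hq => one_div_rogersRamanujanR_pow_five_dissection hq
  obtain ⟨B, hB1, hB2⟩ := exists_expansion_of_dissection 0 hB
    (by
      simp only [Fin.forall_fin_succ]
      exact ⟨⟨_, hB⟩, hterm _ _ _ _ _ _, hterm _ _ _ _ _ _, hterm _ _ _ _ _ _,
        hterm _ _ _ _ _ _, fun i => i.elim0⟩)
    fun q hq => rogersRamanujanR_pow_five_dissection hq
  obtain ⟨D, hD1, hD2⟩ := exists_expansion_of_dissection 1 hD
    (by
      obtain ⟨φ, hφ⟩ := hterm 1 (-36) 5 0 0 0
      simp only [Fin.forall_fin_succ]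
      exact ⟨⟨_, hφ.add (expands_monomial (-1) 2 0 5)⟩, ⟨_, hD⟩, hterm _ _ _ _ _ _,
        hterm _ _ _ _ _ _, hterm _ _ _ _ _ _, fun i => i.elim0⟩)
    fun q hq => rogersRamanujanR_div_dissection hq
  refine ⟨A, B, D, hA1, hB1, hD1, fun n hn => ?_, fun n hn => ?_, fun n => ?_⟩
  · obtain ⟨n, rfl⟩ : ∃ m, n = m + 1 := ⟨n - 1, by omega⟩
    have h1 := abs_coeff_succ_le rogersSeriesInv_majorizes majorizes_rogersInvMajorant n
    have h2 := one_le_coeff majorizes_rogersInvMajorant n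
    have h3 := hA2 (n + 1)
    rw [map_sub, coeff_C_mul, coeff_succ_X_mul] at h3
    rw [Fin.val_zero, add_zero] at h3
    rw [h3]
    linarith [le_abs_self (coeff (n + 1) rogersSeriesInv)]
  · obtain ⟨n, rfl⟩ : ∃ m, n = m + 1 := ⟨n - 1, by omega⟩
    have h1 := abs_coeff_succ_le rogersSeries_majorizes majorizes_rogersMajorant n
    have h2 := one_le_coeff majorizes_rogersMajorant n
    have h3 := hB2 (n + 1)
    rw [map_sub, coeff_C_mul, coeff_succ_X_mul] at h3
    rw [Fin.val_zero, add_zero] at h3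
    rw [h3]
    linarith [le_abs_self (coeff (n + 1) rogersSeries)]
  · have h3 := hD2 n
    rw [Fin.val_one] at h3
    rw [h3, coeff_C_mul, map_add, map_add, coeff_C_mul]
    have h4 : 0 ≤ coeff n (X ^ 2 * ((residueSeriesInv 2 * residueSeriesInv 3) ^ 2) ^ 6) :=
      ((Majorizes.X.pow 2).mul (((one_majorizes_mul
        (one_majorizes_residueSeriesInv (c := 2) (by norm_num))
        (one_majorizes_residueSeriesInv (c := 3) (by norm_num))).pow 2).pow 6)).coeff_nonneg n
    cases n with
    | zero =>
      rw [coeff_zero_rogersSeries, coeff_zero_X_mul]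
      linarith
    | succ n =>
      have h1 := abs_coeff_succ_le rogersSeries_majorizes majorizes_rogersMajorant n
      have h2 := one_le_coeff majorizes_rogersMajorant n
      rw [coeff_succ_X_mul]
      linarith [neg_abs_le (coeff (n + 1) rogersSeries)]
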